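/- **Setting.** Let $d\in\{2,3\}$, let $\Omega\subset\mathbb R^d$ be a bounded open set, and let $\chi,\mu,\upsilon,\eta,\zeta,\kappa>0$. Write $(\cdot,\cdot)$ and $\|\cdot\|$ for the inner product and norm of $L^2(\Omega)$, and $e=(0,1)$ or $e=(0,0,1)$. Let $T_h$ be a conforming partition of $\overline\Omega$ into closed simplices $K$ (of any size and shape) and $k,l,r,s\ge 0$ integers. Let $X_h$, $W_h$, $\mathcal T_h$ be the spaces of continuous functions on $\overline\Omega$ that are polynomials of degree $\le k$, $\le r$, $\le s$ on every $K$ and belong to $H^1_0(\Omega)$, where the functions in $X_h$ have values in $\mathbb R^d$, those in $\mathcal T_h$ are scalar, and those in $W_h$ have values in $\mathbb R^3$ if $d=3$ and in $\mathbb R$ if $d=2$. Let $M_h$ be the space of continuous scalar functions on $\overline\Omega$ of mean zero that are polynomials of degree $\le l$ on every $K$. For $d=2$, as usual, $\nabla\times\omega=(\partial_y\omega,-\partial_x\omega)$ and $\nabla\cdot\omega=0$ for scalar $\omega$, and $\nabla\times v=\partial_xv_2-\partial_yv_1$. For $v\in X_h+\nabla M_h$ the curl $\nabla\times v$ is taken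 in the weak sense. Let $$b(w,a,c)=\tfrac12((w\cdot\nabla)a,c)-\tfrac12((w\cdot\nabla)c,a)$$ be the skew-symmetric form of the convective term. A field $v$ is called weakly divergence free if $(v,\nabla q)=0$ for all $q\in M_h$. For a sequence $f^0,f^1,\dots$ put $\bar f^n=2f^n-f^{n-1}$ for $n\ge1$ and $\bar f^0=f^0$. **Scheme.** Let $\delta_t>0$ and $N\ge0$. The step $(n-1,n)\mapsto n+1$, for $1\le n\le N$, is: $\tilde u^{n+1}\in X_h$, $p^{n+1}\in M_h$, $\omega^{n+1}\in W_h$, $\theta^{n+1}\in\mathcal T_h$, and for all $v\in X_h$, $q\in M_h$, $\Lambda\in W_h$, $\psi\in\mathcal T_h$, $$\Big(\tfrac{3\tilde u^{n+1}-4u^n+u^{n-1}}{2\delta_t},v\Big)+(\chi+\mu)(\nabla\tilde u^{n+1},\nabla v)+b(\bar u^n,\tilde u^{n+1},v)+(\nabla p^n,v)=2\chi(\nabla\times\bar\omega^n,v)+(\bar\theta^ne,v),$$ $$(\nabla p^{n+1},\nabla q)=-\tfrac{3}{2\delta_t}(\nabla\cdot\tilde u^{n+1},q)+(\nabla p^n,\nabla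 q),\qquad u^{n+1}=\tilde u^{n+1}-\tfrac{2\delta_t}{3}\nabla p^{n+1}+\tfrac{2\delta_t}{3}\nabla p^n,$$ $$\zeta\Big(\tfrac{3\omega^{n+1}-4\omega^n+\omega^{n-1}}{2\delta_t},\Lambda\Big)+\upsilon(\nabla\omega^{n+1},\nabla\Lambda)+\zeta b(\bar u^n,\omega^{n+1},\Lambda)+\eta(\nabla\cdot\omega^{n+1},\nabla\cdot\Lambda)+4\chi(\omega^{n+1},\Lambda)=2\chi(\nabla\times\bar u^n,\Lambda),$$ $$\Big(\tfrac{3\theta^{n+1}-4\theta^n+\theta^{n-1}}{2\delta_t},\psi\Big)+\kappa(\nabla\theta^{n+1},\nabla\psi)+b(\bar u^n,\theta^{n+1},\psi)=(\bar u^n\cdot e,\psi).$$ *Starting values.* Values at level $m$ are admissible if $u^m\in X_h+\nabla M_h$ is weakly divergence free, $p^m\in M_h$, $\omega^m\in W_h$, $\theta^m\in\mathcal T_h$. (For example, $u^0$ is the $L^2$ projection onto $X_h+\nabla M_h$ of a solenoidal field with zero normal trace.) The *first-order starting step* produces level $1$ from level $0$ by the same equations with $n=0$, where the difference quotients are replaced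 by $(\tilde u^1-u^0)/\delta_t$, $(\omega^1-\omega^0)/\delta_t$, $(\theta^1-\theta^0)/\delta_t$, the factor $\tfrac{3}{2\delta_t}$ by $\tfrac1{\delta_t}$, and $\tfrac{2\delta_t}{3}$ by $\delta_t$. **Theorem 3.1 (unconditional stability).** There is a constant $C>0$, depending only on $\Omega$ and the parameters $\chi,\mu,\upsilon,\eta,\zeta,\kappa$ (so not on the mesh, $h$, $\delta_t$, $N$, the polynomial degrees or the solution), such that the following holds for every $T_h$, $k,l,r,s$, every $\delta_t>0$, every $N\ge0$ and every solution of the scheme with admissible values at level $0$. Put $$\begin{aligned}L_N={}&\|u^{N+1}\|^2+\|2u^{N+1}-u^N\|^2+\zeta\|\omega^{N+1}\|^2+\zeta\|2\omega^{N+1}-\omega^N\|^2+\|\theta^{N+1}\|^2+\|2\theta^{N+1}-\theta^N\|^2\\&+\sum_{n=1}^N\Big(\|u^{n+1}-2u^n+u^{n-1}\|^2+\zeta\|\omega^{n+1}-2\omega^n+\omega^{n-1}\|^2+\|\theta^{n+1}-2\theta^n+\theta^{n-1}\|^2\Big)\\&+\delta_t\sum_{n=1}^N\Big((\chi+\mu)\|\nabla\tilde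 u^{n+1}\|^2+\upsilon\|\nabla\omega^{n+1}\|^2+4\eta\|\nabla\cdot\omega^{n+1}\|^2+16\chi\|\omega^{n+1}\|^2+\kappa\|\nabla\theta^{n+1}\|^2\Big)+\tfrac{\delta_t^2}{3}\|\nabla p^{N+1}\|^2,\end{aligned}$$ $$I_m=\|u^m\|^2+\|2u^1-u^0\|^2+\zeta\|\omega^m\|^2+\zeta\|2\omega^1-\omega^0\|^2+\|\theta^m\|^2+\|2\theta^1-\theta^0\|^2\qquad(m=0,1).$$ 1. If the values at level $1$ are admissible as well (computed in any way), then $$L_N\le I_1+\tfrac{4\delta_t^2}{3}\|\nabla p^1\|^2+C\delta_t\sum_{n=1}^N\big(\|\bar u^n\|^2+\|\bar\omega^n\|^2+\|\bar\theta^n\|^2\big).$$ 2. If the values at level $1$ are produced by the first-order starting step, then $$L_N\le I_0+\tfrac{3\delta_t^2}{2}\|\nabla p^0\|^2+C\delta_t\sum_{n=0}^N\big(\|\bar u^n\|^2+\|\bar\omega^n\|^2+\|\bar\theta^n\|^2\big).$$ -/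

import Mathlib

open MeasureTheory Filter Topology
open scoped ContDiff

noncomputable section

namespace Micropolar

/-- The space `ℝ^d` with its Euclidean norm. -/
abbrev E (d : ℕ) := EuclideanSpace ℝ (Fin d)

/-- Number of components of the angular velocity: `3` for `d = 3`, and `1` for `d = 2`
(plane flow, where the angular velocity is a scalar, perpendicular to the plane). -/
abbrev spinDim (d : ℕ) : ℕ := d * (d - 1) / 2

/-! ### Sobolev spaces on an open set -/

/-- `φ ∈ C_c^∞(Ω)`. -/
def IsTest {d : ℕ} (Ω : Set (E d)) (φ : E d → ℝ) : Prop :=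
  ContDiff ℝ ∞ φ ∧ HasCompactSupport φ ∧ tsupport φ ⊆ Ω

/-- Classical partial derivative `∂_j φ`. -/
def pderiv {d : ℕ} (j : Fin d) (φ : E d → ℝ) (x : E d) : ℝ :=
  fderiv ℝ φ x (EuclideanSpace.single j 1)

/-- `g ∈ L²(Ω)` is the weak partial derivative `∂_j f` in `Ω`. -/
def HasWeakPartial {d : ℕ} (Ω : Set (E d)) (j : Fin d) (f g : E d → ℝ) : Prop :=
  MemLp g 2 (volume.restrict Ω) ∧
    ∀ φ : E d → ℝ, IsTest Ω φ → ∫ x in Ω, f x * pderiv j φ x = - ∫ x in Ω, g x * φ x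

open Classical in
/-- The weak partial derivative `∂_j f` in `Ω` (it is unique almost everywhere; it is `0` by
convention if `f` has none in `L²(Ω)`). -/
def weakPartial {d : ℕ} (Ω : Set (E d)) (j : Fin d) (f : E d → ℝ) : E d → ℝ :=
  if h : ∃ g, HasWeakPartial Ω j f g then h.choose else 0

/-- `f ∈ H¹(Ω)`. -/
def MemH1 {d : ℕ} (Ω : Set (E d)) (f : E d → ℝ) : Prop :=
  MemLp f 2 (volume.restrict Ω) ∧ ∀ j, ∃ g, HasWeakPartial Ω j f g

/-- `f ∈ H¹₀(Ω)`: `f` is a limit of test functions in the norm of `H¹(Ω)`. -/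
def MemH10 {d : ℕ} (Ω : Set (E d)) (f : E d → ℝ) : Prop :=
  MemH1 Ω f ∧ ∃ φ : ℕ → E d → ℝ, (∀ n, IsTest Ω (φ n)) ∧
    Tendsto (fun n => eLpNorm (fun x => f x - φ n x) 2 (volume.restrict Ω)) atTop (𝓝 0) ∧
    ∀ j, Tendsto (fun n => eLpNorm (fun x => weakPartial Ω j f x - pderiv j (φ n) x) 2
      (volume.restrict Ω)) atTop (𝓝 0)

/-! ### Inner products and differential operators -/

/-- The `L²(Ω)` inner product of scalar or vector fields. -/
def ip {d : ℕ} (Ω : Set (E d)) {F : Type*} [NormedAddCommGroup F] [InnerProductSpace ℝ F]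
    (a b : E d → F) : ℝ :=
  ∫ x in Ω, inner ℝ (a x) (b x)

/-- The squared `L²(Ω)` norm. -/
def nsq {d : ℕ} (Ω : Set (E d)) {F : Type*} [NormedAddCommGroup F] (a : E d → F) : ℝ :=
  ∫ x in Ω, ‖a x‖ ^ 2

/-- The weak gradient of a scalar field. -/
def grad {d : ℕ} (Ω : Set (E d)) (q : E d → ℝ) (x : E d) : E d :=
  WithLp.toLp 2 fun j => weakPartial Ω j q x

/-- The weak gradient `(∂_j a_i)_{i,j}` of a vector field; the norm of the value is the
Frobenius norm. -/
def jac {d m : ℕ} (Ω : Set (E d)) (a : E d → E m) (x : E d) : EuclideanSpace ℝ (Fin m × Fin d) :=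
  WithLp.toLp 2 fun ij => weakPartial Ω ij.2 (fun y => a y ij.1) x

/-- The divergence of a velocity field. -/
def divg {d : ℕ} (Ω : Set (E d)) (v : E d → E d) (x : E d) : ℝ :=
  ∑ i, weakPartial Ω i (fun y => v y i) x

/-- The index in `{0, 1, 2}` of the axis to which the `a`-th component of the angular velocity
belongs: `a` itself for `d = 3`, and the axis `2` perpendicular to the plane for `d = 2`. -/
def axis {d : ℕ} (a : Fin (spinDim d)) : ℕ := 3 - spinDim d + a

/-- The Levi-Civita symbol on `{0, 1, 2}`. -/
def levi (i j k : ℕ) : ℝ := ((j : ℝ) - i) * ((k : ℝ) - i) * ((k : ℝ) - j) / 2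

/-- The divergence of the angular velocity (which is `0` for `d = 2`). -/
def divSpin {d : ℕ} (Ω : Set (E d)) (w : E d → E (spinDim d)) (x : E d) : ℝ :=
  ∑ a, ∑ j : Fin d, if (j : ℕ) = axis a then weakPartial Ω j (fun y => w y a) x else 0

/-- `∇ × ω`: the usual curl for `d = 3`, and `(∂_y ω, -∂_x ω)` for `d = 2`. -/
def curlSpin {d : ℕ} (Ω : Set (E d)) (w : E d → E (spinDim d)) (x : E d) : E d :=
  WithLp.toLp 2 fun i =>
    ∑ j : Fin d, ∑ a, levi i j (axis a) * weakPartial Ω j (fun y => w y a) x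

/-- `∇ × φ` in the classical sense, for a smooth `φ` with values in the space of angular
velocities. -/
def curlTest {d : ℕ} (φ : E d → E (spinDim d)) (x : E d) : E d :=
  WithLp.toLp 2 fun i => ∑ j : Fin d, ∑ a, levi i j (axis a) * pderiv j (fun y => φ y a) x

/-- `c ∈ L²(Ω)` is the weak curl of the field `v`. -/
def HasWeakCurl {d : ℕ} (Ω : Set (E d)) (v : E d → E d) (c : E d → E (spinDim d)) : Prop :=
  MemLp c 2 (volume.restrict Ω) ∧
    ∀ φ : E d → E (spinDim d), (∀ a, IsTest Ω (fun x => φ x a)) → ip Ω c φ = ip Ω v (curlTest φ)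

open Classical in
/-- `∇ × v` for a velocity field `v`, in the weak sense: the usual curl for `d = 3`, and
`∂_x v_2 - ∂_y v_1` for `d = 2`. It is meaningful for sums of an `H¹` field and a gradient, whose
single partial derivatives need not be square integrable. -/
def curl {d : ℕ} (Ω : Set (E d)) (v : E d → E d) : E d → E (spinDim d) :=
  if h : ∃ c, HasWeakCurl Ω v c then h.choose else 0

/-- `((w · ∇) a, c)` for vector fields `a`, `c`. -/
def convForm {d m : ℕ} (Ω : Set (E d)) (w : E d → E d) (a c : E d → E m) : ℝ :=
  ∫ x in Ω, ∑ i, (∑ j, w x j * weakPartial Ω j (fun y => a y i) x) * c x i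

/-- The skew-symmetric trilinear form
`b(w, a, c) = ½ ((w · ∇) a, c) - ½ ((w · ∇) c, a)` for vector fields `a`, `c`. -/
def bForm {d m : ℕ} (Ω : Set (E d)) (w : E d → E d) (a c : E d → E m) : ℝ :=
  (1 / 2) * convForm Ω w a c - (1 / 2) * convForm Ω w c a

/-- `((w · ∇) f, g)` for scalar fields `f`, `g`. -/
def convFormS {d : ℕ} (Ω : Set (E d)) (w : E d → E d) (f g : E d → ℝ) : ℝ :=
  ∫ x in Ω, (∑ j, w x j * weakPartial Ω j f x) * g x

/-- The skew-symmetric trilinear form for scalar fields. -/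
def bFormS {d : ℕ} (Ω : Set (E d)) (w : E d → E d) (f g : E d → ℝ) : ℝ :=
  (1 / 2) * convFormS Ω w f g - (1 / 2) * convFormS Ω w g f

/-- The unit vector `(0, 1)` or `(0, 0, 1)`. -/
def vert (d : ℕ) : E d := WithLp.toLp 2 fun i => if (i : ℕ) + 1 = d then 1 else 0

/-! ### Finite element spaces -/

/-- A conforming partition of the closure of `Ω` into finitely many nondegenerate closed simplices,
each given by its set of vertices: two simplices meet in a common face or not at all. -/
structure Triangulation {d : ℕ} (Ω : Set (E d)) where
  cells : Finset (Finset (E d))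
  card_eq : ∀ K ∈ cells, K.card = d + 1
  indep : ∀ K ∈ cells, AffineIndependent ℝ ((↑) : K → E d)
  inter : ∀ K ∈ cells, ∀ L ∈ cells,
    convexHull ℝ (K : Set (E d)) ∩ convexHull ℝ (L : Set (E d)) =
      convexHull ℝ ((K : Set (E d)) ∩ (L : Set (E d)))
  cover : (⋃ K ∈ cells, convexHull ℝ (K : Set (E d))) = closure Ω

variable {d : ℕ} {Ω : Set (E d)}

/-- Functions that are continuous on the closure of `Ω` and polynomial of degree at most `k` on
every simplex. -/
def IsPiecewisePoly (T : Triangulation Ω) (k : ℕ) (f : E d → ℝ) : Prop :=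
  ContinuousOn f (closure Ω) ∧ ∀ K ∈ T.cells, ∃ P : MvPolynomial (Fin d) ℝ, P.totalDegree ≤ k ∧
    ∀ x ∈ convexHull ℝ (K : Set (E d)), f x = MvPolynomial.eval (fun i => x i) P

/-- The scalar space of continuous piecewise polynomials in `H¹₀(Ω)`. -/
def ScalarFE (T : Triangulation Ω) (s : ℕ) (f : E d → ℝ) : Prop :=
  IsPiecewisePoly T s f ∧ MemH10 Ω f

/-- The space of vector fields with `m` components in the scalar space. -/
def VectorFE (T : Triangulation Ω) {m : ℕ} (k : ℕ) (v : E d → E m) : Prop :=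
  ∀ i, ScalarFE T k fun x => v x i

/-- The pressure space `M_h`: continuous piecewise polynomials of mean zero (they are in `H¹(Ω)`
automatically). -/
def PressureFE (T : Triangulation Ω) (l : ℕ) (q : E d → ℝ) : Prop :=
  IsPiecewisePoly T l q ∧ MemH1 Ω q ∧ ∫ x in Ω, q x = 0

/-- `v ∈ X_h + ∇ M_h`. -/
def VelocitySum (T : Triangulation Ω) (k l : ℕ) (v : E d → E d) : Prop :=
  ∃ w q, VectorFE T k w ∧ PressureFE T l q ∧
    ∀ᵐ x ∂volume.restrict Ω, v x = w x + grad Ω q x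

/-- `v` is weakly divergence free with respect to `M_h`. -/
def WeaklyDivFree (T : Triangulation Ω) (l : ℕ) (v : E d → E d) : Prop :=
  ∀ q, PressureFE T l q → ip Ω v (grad Ω q) = 0

/-! ### The scheme -/

/-- The physical parameters `χ, μ, υ, η, ζ, κ`. -/
structure Params where
  chi : ℝ
  mu : ℝ
  ups : ℝ
  eta : ℝ
  zeta : ℝ
  kappa : ℝ
  chi_pos : 0 < chi
  mu_pos : 0 < mu
  ups_pos : 0 < ups
  eta_pos : 0 < eta
  zeta_pos : 0 < zeta
  kappa_pos : 0 < kappa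

/-- Sequences of discrete fields: predicted velocity `ut`, velocity `u`, pressure `p`, angular
velocity `w`, temperature `th`. -/
structure Fields (d : ℕ) where
  ut : ℕ → E d → E d
  u : ℕ → E d → E d
  p : ℕ → E d → ℝ
  w : ℕ → E d → E (spinDim d)
  th : ℕ → E d → ℝ

/-- Extrapolated values `2 f^n - f^{n-1}` for `n ≥ 1`, and `f^0` for `n = 0`. -/
def extrap {F : Type*} [NormedAddCommGroup F] [Module ℝ F] (f : ℕ → E d → F) : ℕ → E d → F
  | 0 => f 0
  | n + 1 => fun x => (2 : ℝ) • f (n + 1) x - f n x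

/-- One step `(n - 1, n) ↦ n + 1` (with `n ≥ 1`) of the BDF2 pressure projection scheme with time
step `δ`. -/
structure IsStep (P : Params) (T : Triangulation Ω) (k l r s : ℕ) (δ : ℝ) (S : Fields d)
    (n : ℕ) : Prop where
  ut_mem : VectorFE T k (S.ut (n + 1))
  p_mem : PressureFE T l (S.p (n + 1))
  w_mem : VectorFE T r (S.w (n + 1))
  th_mem : ScalarFE T s (S.th (n + 1))
  momentum : ∀ v, VectorFE T k v →
    ip Ω (fun x => (2 * δ)⁻¹ • ((3 : ℝ) • S.ut (n + 1) x - (4 : ℝ) • S.u n x + S.u (n - 1) x)) v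
      + (P.chi + P.mu) * ip Ω (jac Ω (S.ut (n + 1))) (jac Ω v)
      + bForm Ω (extrap S.u n) (S.ut (n + 1)) v
      + ip Ω (grad Ω (S.p n)) v
    = 2 * P.chi * ip Ω (curlSpin Ω (extrap S.w n)) v
      + ip Ω (fun x => extrap S.th n x • vert d) v
  pressure : ∀ q, PressureFE T l q →
    ip Ω (grad Ω (S.p (n + 1))) (grad Ω q)
    = - (3 / (2 * δ)) * ip Ω (divg Ω (S.ut (n + 1))) q + ip Ω (grad Ω (S.p n)) (grad Ω q)
  velocity : ∀ᵐ x ∂volume.restrict Ω,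
    S.u (n + 1) x = S.ut (n + 1) x - (2 * δ / 3) • grad Ω (S.p (n + 1)) x
      + (2 * δ / 3) • grad Ω (S.p n) x
  spin : ∀ z, VectorFE T r z →
    P.zeta * ip Ω (fun x => (2 * δ)⁻¹ •
        ((3 : ℝ) • S.w (n + 1) x - (4 : ℝ) • S.w n x + S.w (n - 1) x)) z
      + P.ups * ip Ω (jac Ω (S.w (n + 1))) (jac Ω z)
      + P.zeta * bForm Ω (extrap S.u n) (S.w (n + 1)) z
      + P.eta * ip Ω (divSpin Ω (S.w (n + 1))) (divSpin Ω z)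
      + 4 * P.chi * ip Ω (S.w (n + 1)) z
    = 2 * P.chi * ip Ω (curl Ω (extrap S.u n)) z
  temperature : ∀ g, ScalarFE T s g →
    ip Ω (fun x => (2 * δ)⁻¹ * (3 * S.th (n + 1) x - 4 * S.th n x + S.th (n - 1) x)) g
      + P.kappa * ip Ω (grad Ω (S.th (n + 1))) (grad Ω g)
      + bFormS Ω (extrap S.u n) (S.th (n + 1)) g
    = ip Ω (fun x => inner ℝ (extrap S.u n x) (vert d)) g

/-- The starting step `0 ↦ 1` by the first-order pressure projection scheme with time step `δ`. -/
structure IsFirstStep (P : Params) (T : Triangulation Ω) (k l r s : ℕ) (δ : ℝ) (S : Fields d) :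
    Prop where
  ut_mem : VectorFE T k (S.ut 1)
  p_mem : PressureFE T l (S.p 1)
  w_mem : VectorFE T r (S.w 1)
  th_mem : ScalarFE T s (S.th 1)
  momentum : ∀ v, VectorFE T k v →
    ip Ω (fun x => δ⁻¹ • (S.ut 1 x - S.u 0 x)) v
      + (P.chi + P.mu) * ip Ω (jac Ω (S.ut 1)) (jac Ω v)
      + bForm Ω (S.u 0) (S.ut 1) v
      + ip Ω (grad Ω (S.p 0)) v
    = 2 * P.chi * ip Ω (curlSpin Ω (S.w 0)) v + ip Ω (fun x => S.th 0 x • vert d) v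
  pressure : ∀ q, PressureFE T l q →
    ip Ω (grad Ω (S.p 1)) (grad Ω q)
    = - (1 / δ) * ip Ω (divg Ω (S.ut 1)) q + ip Ω (grad Ω (S.p 0)) (grad Ω q)
  velocity : ∀ᵐ x ∂volume.restrict Ω,
    S.u 1 x = S.ut 1 x - δ • grad Ω (S.p 1) x + δ • grad Ω (S.p 0) x
  spin : ∀ z, VectorFE T r z →
    P.zeta * ip Ω (fun x => δ⁻¹ • (S.w 1 x - S.w 0 x)) z
      + P.ups * ip Ω (jac Ω (S.w 1)) (jac Ω z)
      + P.zeta * bForm Ω (S.u 0) (S.w 1) z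
      + P.eta * ip Ω (divSpin Ω (S.w 1)) (divSpin Ω z)
      + 4 * P.chi * ip Ω (S.w 1) z
    = 2 * P.chi * ip Ω (curl Ω (S.u 0)) z
  temperature : ∀ g, ScalarFE T s g →
    ip Ω (fun x => δ⁻¹ * (S.th 1 x - S.th 0 x)) g
      + P.kappa * ip Ω (grad Ω (S.th 1)) (grad Ω g)
      + bFormS Ω (S.u 0) (S.th 1) g
    = ip Ω (fun x => inner ℝ (S.u 0 x) (vert d)) g

/-- The fields at time level `n` are admissible starting values: `u^n ∈ X_h + ∇ M_h` is weakly
divergence free, `p^n ∈ M_h`, `ω^n ∈ W_h` and `θ^n ∈ 𝒯_h`. -/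
structure IsStart (T : Triangulation Ω) (k l r s : ℕ) (S : Fields d) (n : ℕ) : Prop where
  u_mem : VelocitySum T k l (S.u n)
  u_div : WeaklyDivFree T l (S.u n)
  p_mem : PressureFE T l (S.p n)
  w_mem : VectorFE T r (S.w n)
  th_mem : ScalarFE T s (S.th n)

/-- The squared norm of a second difference `f^{n+1} - 2 f^n + f^{n-1}`. -/
def secondDiffSq (Ω : Set (E d)) {F : Type*} [NormedAddCommGroup F] [Module ℝ F]
    (f : ℕ → E d → F) (n : ℕ) : ℝ :=
  nsq Ω fun x => f (n + 1) x - (2 : ℝ) • f n x + f (n - 1) x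

/-- The left-hand side of the stability estimate. -/
def stabilityLHS (Ω : Set (E d)) (P : Params) (δ : ℝ) (S : Fields d) (N : ℕ) : ℝ :=
  nsq Ω (S.u (N + 1)) + nsq Ω (fun x => (2 : ℝ) • S.u (N + 1) x - S.u N x)
    + P.zeta * nsq Ω (S.w (N + 1)) + P.zeta * nsq Ω (fun x => (2 : ℝ) • S.w (N + 1) x - S.w N x)
    + nsq Ω (S.th (N + 1)) + nsq Ω (fun x => (2 : ℝ) * S.th (N + 1) x - S.th N x)
    + ∑ n ∈ Finset.Icc 1 N,
        (secondDiffSq Ω S.u n + P.zeta * secondDiffSq Ω S.w n + secondDiffSq Ω S.th n)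
    + δ * ∑ n ∈ Finset.Icc 1 N,
        ((P.chi + P.mu) * nsq Ω (jac Ω (S.ut (n + 1))) + P.ups * nsq Ω (jac Ω (S.w (n + 1)))
          + 4 * P.eta * nsq Ω (divSpin Ω (S.w (n + 1))) + 16 * P.chi * nsq Ω (S.w (n + 1))
          + P.kappa * nsq Ω (grad Ω (S.th (n + 1))))
    + δ ^ 2 / 3 * nsq Ω (grad Ω (S.p (N + 1)))

/-- `‖u^m‖² + ‖2u^1 - u^0‖² + ζ‖ω^m‖² + ζ‖2ω^1 - ω^0‖² + ‖θ^m‖² + ‖2θ^1 - θ^0‖²`, for `m = 0, 1`. -/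
def initialEnergy (Ω : Set (E d)) (P : Params) (S : Fields d) (m : ℕ) : ℝ :=
  nsq Ω (S.u m) + nsq Ω (fun x => (2 : ℝ) • S.u 1 x - S.u 0 x)
    + P.zeta * nsq Ω (S.w m) + P.zeta * nsq Ω (fun x => (2 : ℝ) • S.w 1 x - S.w 0 x)
    + nsq Ω (S.th m) + nsq Ω (fun x => (2 : ℝ) * S.th 1 x - S.th 0 x)

/-- The sum of the squared norms of the extrapolated fields at level `n`. -/
def extrapSq (Ω : Set (E d)) (S : Fields d) (n : ℕ) : ℝ :=
  nsq Ω (extrap S.u n) + nsq Ω (extrap S.w n) + nsq Ω (extrap S.th n)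

end Micropolar

end

/-! Each equation is tested with its own new unknown. The convective terms vanish because the
trilinear form is skew-symmetric, and the difference quotient is treated by the identity 2(3a - 4b +
c, a) = ‖a‖² + ‖2a - b‖² + ‖a - 2b + c‖² - ‖b‖² - ‖2b - c‖², whose first-order part telescopes
(`bdf2_energy`).

In the momentum equation the quotient mixes the predicted velocity with projected ones. The pressure
equation says exactly that the projected velocity is L²-orthogonal to the gradients of `M_h`
(`projection_regular`). Substituting ũ = u + (2δ/3)∇(p^{n+1} - p^n) therefore decouples velocity and
pressure: the cross terms vanish, and what remains is (4δ²/3)(‖∇p^{n+1}‖² - ‖∇p^n‖²), which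
telescopes, plus a nonnegative square (`bdf2_projection_energy`).

The right-hand sides are explicit in the extrapolated fields. Curls are moved onto the test
function, which lies in H¹₀; the remaining terms use the Poincaré inequality; Young's inequality
then costs half of the viscous dissipation plus a multiple of the squared L² norms of the data
(`exists_source_le`). For the velocity this needs the weak curl, which exists because gradients have
weak curl zero (`hasWeakCurl_grad`). The data norms stay on the right, so no Gronwall argument and
no restriction on δ enters.

The Euler starting step is treated in the same way; its pressure terms are arranged to yield the
weight 4/3 with which the second-order sum begins (`euler_projection_energy`). -/

namespace Micropolar

/-! ### Fields as elements of L²(Ω) -/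

section Normed

variable {d : ℕ} {Ω : Set (E d)} {F : Type*} [NormedAddCommGroup F]

theorem nsq_nonneg (a : E d → F) : 0 ≤ nsq Ω a :=
  integral_nonneg fun _ => by positivity

theorem tendsto_toLp {f : E d → F} {φ : ℕ → E d → F} (hf : MemLp f 2 (volume.restrict Ω))
    (hφ : ∀ n, MemLp (φ n) 2 (volume.restrict Ω))
    (h : Tendsto (fun n => eLpNorm (fun x => f x - φ n x) 2 (volume.restrict Ω)) atTop (𝓝 0)) :
    Tendsto (fun n => (hφ n).toLp (φ n)) atTop (𝓝 (hf.toLp f)) := by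
  rw [Lp.tendsto_Lp_iff_tendsto_eLpNorm'' φ hφ f hf]
  refine h.congr fun n => ?_
  rw [← eLpNorm_neg]
  congr 1
  ext x
  simp

end Normed

section L2

variable {d : ℕ} {Ω : Set (E d)} {F : Type*} [NormedAddCommGroup F] [InnerProductSpace ℝ F]

/-- The `L²(Ω)` inner product of square integrable fields is the inner product of `L²(Ω)`. -/
theorem ip_eq_inner {a b : E d → F} (ha : MemLp a 2 (volume.restrict Ω))
    (hb : MemLp b 2 (volume.restrict Ω)) : ip Ω a b = inner ℝ (ha.toLp a) (hb.toLp b) := by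
  rw [L2.inner_def, ip]
  refine integral_congr_ae ?_
  filter_upwards [ha.coeFn_toLp, hb.coeFn_toLp] with x h1 h2
  rw [h1, h2]

theorem nsq_eq_ip (a : E d → F) : nsq Ω a = ip Ω a a := by
  simp [nsq, ip]

theorem nsq_eq_norm_sq {a : E d → F} (ha : MemLp a 2 (volume.restrict Ω)) :
    nsq Ω a = ‖ha.toLp a‖ ^ 2 := by
  rw [nsq_eq_ip, ip_eq_inner ha ha, real_inner_self_eq_norm_sq]

theorem abs_ip_le {a b : E d → F} (ha : MemLp a 2 (volume.restrict Ω))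
    (hb : MemLp b 2 (volume.restrict Ω)) : |ip Ω a b| ≤ √(nsq Ω a) * √(nsq Ω b) := by
  rw [ip_eq_inner ha hb, nsq_eq_norm_sq ha, nsq_eq_norm_sq hb, Real.sqrt_sq (norm_nonneg _),
    Real.sqrt_sq (norm_nonneg _)]
  exact abs_real_inner_le_norm _ _

theorem ip_congr_ae {a a' b : E d → F} (h : a =ᵐ[volume.restrict Ω] a') :
    ip Ω a b = ip Ω a' b := by
  refine integral_congr_ae ?_
  filter_upwards [h] with x hx
  rw [hx]

theorem ip_comm (a b : E d → F) : ip Ω a b = ip Ω b a := by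
  simp only [ip, real_inner_comm]

theorem ip_real (a b : E d → ℝ) : ip Ω a b = ∫ x in Ω, a x * b x := by
  simp [ip, mul_comm]

theorem ip_add_left {a a' b : E d → F} (ha : MemLp a 2 (volume.restrict Ω))
    (ha' : MemLp a' 2 (volume.restrict Ω)) (hb : MemLp b 2 (volume.restrict Ω)) :
    ip Ω (fun x => a x + a' x) b = ip Ω a b + ip Ω a' b := by
  rw [ip_eq_inner ha hb, ip_eq_inner ha' hb, ← inner_add_left]
  exact ip_eq_inner (ha.add ha') hb

theorem ip_smul_left {a b : E d → F} (c : ℝ) : ip Ω (fun x => c • a x) b = c * ip Ω a b := by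
  simp only [ip, real_inner_smul_left, integral_const_mul]

theorem ip_sub_left {a a' b : E d → F} (ha : MemLp a 2 (volume.restrict Ω))
    (ha' : MemLp a' 2 (volume.restrict Ω)) (hb : MemLp b 2 (volume.restrict Ω)) :
    ip Ω (fun x => a x - a' x) b = ip Ω a b - ip Ω a' b := by
  rw [ip_eq_inner ha hb, ip_eq_inner ha' hb, ← inner_sub_left]
  exact ip_eq_inner (ha.sub ha') hb

/-- The inner product of Euclidean fields is the sum of the inner products of the components. -/
theorem ip_eq_sum {ι : Type*} [Fintype ι] {a b : E d → EuclideanSpace ℝ ι}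
    (ha : MemLp a 2 (volume.restrict Ω)) (hb : MemLp b 2 (volume.restrict Ω)) :
    ip Ω a b = ∑ i, ip Ω (fun x => a x i) (fun x => b x i) := by
  simp only [ip, PiLp.inner_apply]
  refine integral_finsetSum _ fun i _ => ?_
  have := (ha.eval_piLp i).integrable_mul (hb.eval_piLp i)
  simpa [Pi.mul_def, mul_comm] using this

theorem nsq_eq_sum {ι : Type*} [Fintype ι] {a : E d → EuclideanSpace ℝ ι}
    (ha : MemLp a 2 (volume.restrict Ω)) : nsq Ω a = ∑ i, nsq Ω (fun x => a x i) := by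
  simp only [nsq_eq_ip, ip_eq_sum ha ha]

theorem nsq_component_le {ι : Type*} [Fintype ι] {a : E d → EuclideanSpace ℝ ι}
    (ha : MemLp a 2 (volume.restrict Ω)) (i : ι) : nsq Ω (fun x => a x i) ≤ nsq Ω a := by
  rw [nsq_eq_sum ha]
  exact Finset.single_le_sum (f := fun i => nsq Ω (fun x => a x i)) (fun j _ => nsq_nonneg _)
    (Finset.mem_univ i)

/-- Together with `tendsto_nsq`, this carries identities and inequalities from test functions over
to H¹₀(Ω). -/
theorem tendsto_ip {f g : E d → F} {φ : ℕ → E d → F} (hf : MemLp f 2 (volume.restrict Ω))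
    (hφ : ∀ n, MemLp (φ n) 2 (volume.restrict Ω)) (hg : MemLp g 2 (volume.restrict Ω))
    (h : Tendsto (fun n => eLpNorm (fun x => f x - φ n x) 2 (volume.restrict Ω)) atTop (𝓝 0)) :
    Tendsto (fun n => ip Ω (φ n) g) atTop (𝓝 (ip Ω f g)) := by
  simp only [ip_eq_inner (hφ _) hg, ip_eq_inner hf hg]
  exact (tendsto_toLp hf hφ h).inner tendsto_const_nhds

theorem tendsto_nsq {f : E d → F} {φ : ℕ → E d → F} (hf : MemLp f 2 (volume.restrict Ω))
    (hφ : ∀ n, MemLp (φ n) 2 (volume.restrict Ω))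
    (h : Tendsto (fun n => eLpNorm (fun x => f x - φ n x) 2 (volume.restrict Ω)) atTop (𝓝 0)) :
    Tendsto (fun n => nsq Ω (φ n)) atTop (𝓝 (nsq Ω f)) := by
  simp only [nsq_eq_norm_sq (hφ _), nsq_eq_norm_sq hf]
  exact (tendsto_toLp hf hφ h).norm.pow 2

end L2

/-! ### Integration by parts and the Poincaré inequality -/

section Sobolev

variable {d : ℕ} {Ω : Set (E d)}

theorem IsTest.memLp {φ : E d → ℝ} (h : IsTest Ω φ) : MemLp φ 2 (volume.restrict Ω) :=
  (h.1.continuous.memLp_of_hasCompactSupport h.2.1).restrict Ω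

theorem IsTest.pderiv {φ : E d → ℝ} (h : IsTest Ω φ) (j : Fin d) : IsTest Ω (pderiv j φ) := by
  have hs : tsupport (Micropolar.pderiv j φ) ⊆ tsupport φ := by
    refine closure_minimal (fun x hx => ?_) (isClosed_tsupport φ)
    refine tsupport_fderiv_subset ℝ (subset_tsupport _ ?_)
    intro h0
    exact hx (by simp [Micropolar.pderiv, h0])
  refine ⟨?_, h.2.1.mono' (subset_closure.trans hs), hs.trans h.2.2⟩
  exact (h.1.fderiv_right (m := ∞) (by simp)).clm_apply contDiff_const

theorem MemH1.weakPartial {f : E d → ℝ} (h : MemH1 Ω f) (j : Fin d) :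
    HasWeakPartial Ω j f (weakPartial Ω j f) := by
  rw [Micropolar.weakPartial, dif_pos (h.2 j)]
  exact (h.2 j).choose_spec

theorem MemH1.memLp_weakPartial {f : E d → ℝ} (h : MemH1 Ω f) (j : Fin d) :
    MemLp (Micropolar.weakPartial Ω j f) 2 (volume.restrict Ω) :=
  (h.weakPartial j).1

theorem MemH1.memLp_grad {f : E d → ℝ} (h : MemH1 Ω f) :
    MemLp (grad Ω f) 2 (volume.restrict Ω) :=
  MemLp.of_eval_piLp fun j => h.memLp_weakPartial j

/-- Only membership is claimed: the chosen weak partials of a combination need not be identified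
with the combination of the chosen ones. The case c = 2 serves the extrapolated angular velocity. -/
theorem MemH1.sub_smul {f g : E d → ℝ} (hf : MemH1 Ω f) (hg : MemH1 Ω g) (c : ℝ) :
    MemH1 Ω (fun x => c * f x - g x) := by
  refine ⟨(hf.1.const_mul c).sub hg.1, fun j => ?_⟩
  have h1 := hf.weakPartial j
  have h2 := hg.weakPartial j
  refine ⟨fun x => c * Micropolar.weakPartial Ω j f x - Micropolar.weakPartial Ω j g x,
    (h1.1.const_mul c).sub h2.1, fun φ hφ => ?_⟩
  have hp := (hφ.pderiv j).memLp
  have e1 := h1.2 φ hφ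
  have e2 := h2.2 φ hφ
  rw [← ip_real, ← ip_real] at e1 e2
  rw [← ip_real, ← ip_real, ip_sub_left (hf.1.const_mul c) hg.1 hp,
    ip_sub_left (h1.1.const_mul c) h2.1 hφ.memLp]
  have s1 := ip_smul_left (Ω := Ω) (a := f) (b := Micropolar.pderiv j φ) c
  have s2 := ip_smul_left (Ω := Ω) (a := Micropolar.weakPartial Ω j f) (b := φ) c
  simp only [smul_eq_mul] at s1 s2
  rw [s1, s2, e1, e2]
  ring

/-- Integration by parts for `f ∈ H¹₀(Ω)` and `g ∈ H¹(Ω)`. -/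
theorem MemH10.ip_weakPartial {f g : E d → ℝ} (hf : MemH10 Ω f) (hg : MemH1 Ω g) (j : Fin d) :
    ip Ω (weakPartial Ω j f) g = - ip Ω f (weakPartial Ω j g) := by
  obtain ⟨h1, φ, hφ, hl, hd⟩ := hf
  have a1 := tendsto_ip h1.1 (fun n => (hφ n).memLp) (hg.memLp_weakPartial j) hl
  have a2 := tendsto_ip (h1.memLp_weakPartial j) (fun n => ((hφ n).pderiv j).memLp) hg.1 (hd j)
  -- For test functions in place of `f` the claim is the definition of the weak derivative of `g`;
  -- both sides converge.
  refine tendsto_nhds_unique a2 (a1.neg.congr fun n => ?_)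
  have := (hg.weakPartial j).2 (φ n) (hφ n)
  rw [ip_comm (φ n), ip_comm (pderiv j (φ n)), ip_real, ip_real, this]

/-- The Poincaré inequality for test functions. -/
theorem IsTest.exists_nsq_le (hb : ∃ R : ℝ, ∀ x ∈ Ω, ‖x‖ ≤ R) (j : Fin d) :
    ∃ C : ℝ, 0 ≤ C ∧ ∀ φ : E d → ℝ, IsTest Ω φ → nsq Ω φ ≤ C * nsq Ω (Micropolar.pderiv j φ) := by
  obtain ⟨R, hR⟩ := hb
  -- Integrating φ² · ∂_j x_j by parts gives ‖φ‖² = -2 (x_j φ, ∂_j φ) ≤ 2|R| ‖φ‖ ‖∂_j φ‖; squaring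
  -- and dividing by ‖φ‖² leaves the constant 4R².
  refine ⟨4 * R ^ 2, by positivity, fun φ hφ => ?_⟩
  have hc := hφ.1.continuous
  have hcp := (hφ.pderiv j).1.continuous
  have hdf : Differentiable ℝ φ := hφ.1.differentiable (by simp)
  have hdx : Differentiable ℝ (fun x : E d => x j) := by fun_prop
  have hfx : ∀ x : E d, fderiv ℝ (fun x : E d => x j) x (EuclideanSpace.single j 1) = 1 := by
    intro x
    have : HasFDerivAt (fun x : E d => x j) (EuclideanSpace.proj j : E d →L[ℝ] ℝ) x :=
      (EuclideanSpace.proj j : E d →L[ℝ] ℝ).hasFDerivAt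
    rw [this.fderiv]
    simp
  have hf2 : ∀ x : E d, fderiv ℝ (fun x => φ x * φ x) x (EuclideanSpace.single j 1)
      = 2 * φ x * Micropolar.pderiv j φ x := by
    intro x
    rw [fderiv_fun_mul (hdf x) (hdf x)]
    simp [Micropolar.pderiv]
    ring
  have hs2 : HasCompactSupport fun x => φ x * φ x := hφ.2.1.mul_right
  have key := integral_mul_fderiv_eq_neg_fderiv_mul_of_integrable (μ := (volume : Measure (E d)))
    (f := fun x => φ x * φ x) (g := fun x : E d => x j) (v := EuclideanSpace.single j 1)
    (by
      simp only [hf2]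
      refine Continuous.integrable_of_hasCompactSupport (by fun_prop) ?_
      exact (hφ.2.1.mul_left.mul_right).mul_right)
    (by
      simp only [hfx, mul_one]
      exact (hc.mul hc).integrable_of_hasCompactSupport hs2)
    (Continuous.integrable_of_hasCompactSupport (by fun_prop) hs2.mul_right)
    (fun x _ => (hdf x).mul (hdf x)) (fun x _ => hdx x)
  simp only [hfx, hf2, mul_one] at key
  have hz : ∀ x ∉ Ω, φ x = 0 := fun x hx =>
    image_eq_zero_of_notMem_tsupport fun h => hx (hφ.2.2 h)
  have k1 : nsq Ω φ = ∫ x, φ x * φ x := by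
    rw [nsq, setIntegral_eq_integral_of_forall_compl_eq_zero (by
      intro x hx; simp [hz x hx])]
    simp [sq]
  have hm : MemLp (fun x : E d => x j * φ x) 2 (volume.restrict Ω) :=
    (Continuous.memLp_of_hasCompactSupport (by fun_prop) hφ.2.1.mul_left).restrict Ω
  have k2 : nsq Ω φ = - 2 * ip Ω (fun x => x j * φ x) (Micropolar.pderiv j φ) := by
    rw [k1, key, ip_real, setIntegral_eq_integral_of_forall_compl_eq_zero (by
      intro x hx; simp [hz x hx]), ← integral_const_mul, ← integral_neg]
    congr 1
    ext x
    ring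
  have k3 := abs_ip_le hm (hφ.pderiv j).memLp
  have k4 : nsq Ω (fun x => x j * φ x) ≤ R ^ 2 * nsq Ω φ := by
    rw [nsq, nsq, ← integral_const_mul]
    refine integral_mono hm.norm.integrable_sq (hφ.memLp.norm.integrable_sq.const_mul _)
      fun x => ?_
    by_cases hx : x ∈ Ω
    · have h1 : |x j| ≤ R := (PiLp.norm_apply_le x j).trans (hR x hx)
      simp only [Real.norm_eq_abs, sq_abs, mul_pow]
      exact mul_le_mul_of_nonneg_right (sq_le_sq.2 (h1.trans (le_abs_self R))) (sq_nonneg _)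
    · simp [hz x hx]
  set b := nsq Ω (Micropolar.pderiv j φ)
  set p := nsq Ω φ
  set a := nsq Ω (fun x => x j * φ x)
  have hp : 0 ≤ p := nsq_nonneg _
  have hb : 0 ≤ b := nsq_nonneg _
  have ha : 0 ≤ a := nsq_nonneg _
  have k5 : p ^ 2 ≤ 4 * (a * b) := by
    rw [k2, mul_pow, ← sq_abs (ip _ _ _)]
    calc (-2 : ℝ) ^ 2 * |ip Ω (fun x => x j * φ x) (Micropolar.pderiv j φ)| ^ 2
        ≤ (-2) ^ 2 * (√a * √b) ^ 2 := by gcongr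
      _ = 4 * (a * b) := by rw [mul_pow, Real.sq_sqrt ha, Real.sq_sqrt hb]; ring
  rcases hp.eq_or_lt with h0 | h0
  · rw [← h0]; positivity
  · have : p * p ≤ p * (4 * R ^ 2 * b) := by nlinarith [mul_le_mul_of_nonneg_right k4 hb]
    exact le_of_mul_le_mul_left this h0

/-- The Poincaré inequality in `H¹₀(Ω)`, with a single partial derivative. -/
theorem MemH10.exists_nsq_le (hb : ∃ R : ℝ, ∀ x ∈ Ω, ‖x‖ ≤ R) (j : Fin d) :
    ∃ C : ℝ, 0 ≤ C ∧ ∀ f : E d → ℝ, MemH10 Ω f → nsq Ω f ≤ C * nsq Ω (weakPartial Ω j f) := by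
  obtain ⟨C, hC, h⟩ := IsTest.exists_nsq_le hb j
  refine ⟨C, hC, fun f hf => ?_⟩
  obtain ⟨h1, φ, hφ, hl, hd⟩ := hf
  exact le_of_tendsto_of_tendsto' (tendsto_nsq h1.1 (fun n => (hφ n).memLp) hl)
    ((tendsto_nsq (h1.memLp_weakPartial j) (fun n => ((hφ n).pderiv j).memLp) (hd j)).const_mul C)
    fun n => h _ (hφ n)

theorem memLp_of_memH10 {m : ℕ} {v : E d → E m} (hv : ∀ i, MemH10 Ω fun x => v x i) :
    MemLp v 2 (volume.restrict Ω) :=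
  MemLp.of_eval_piLp fun i => (hv i).1.1

theorem memLp_jac {m : ℕ} {v : E d → E m} (hv : ∀ i, MemH1 Ω fun x => v x i) :
    MemLp (jac Ω v) 2 (volume.restrict Ω) :=
  MemLp.of_eval_piLp fun ij => (hv ij.1).memLp_weakPartial ij.2

theorem nsq_weakPartial_le_jac {m : ℕ} {v : E d → E m} (hv : ∀ i, MemH1 Ω fun x => v x i)
    (i : Fin m) (j : Fin d) : nsq Ω (weakPartial Ω j fun x => v x i) ≤ nsq Ω (jac Ω v) :=
  nsq_component_le (memLp_jac hv) (i, j)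

/-- The Poincaré inequality for scalar functions in `H¹₀(Ω)`. -/
theorem exists_poincare_scalar (hd : 0 < d) (hb : ∃ R : ℝ, ∀ x ∈ Ω, ‖x‖ ≤ R) :
    ∃ C : ℝ, 0 ≤ C ∧ ∀ f : E d → ℝ, MemH10 Ω f → √(nsq Ω f) ≤ C * √(nsq Ω (grad Ω f)) := by
  obtain ⟨C, hC, h⟩ := MemH10.exists_nsq_le hb ⟨0, hd⟩
  refine ⟨√C, by positivity, fun f hf => ?_⟩
  rw [← Real.sqrt_mul hC]
  refine Real.sqrt_le_sqrt ((h f hf).trans ?_)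
  gcongr
  exact nsq_component_le hf.1.memLp_grad ⟨0, hd⟩

/-- The Poincaré inequality for vector fields with components in `H¹₀(Ω)`. -/
theorem exists_poincare_vector (hd : 0 < d) (hb : ∃ R : ℝ, ∀ x ∈ Ω, ‖x‖ ≤ R) (m : ℕ) :
    ∃ C : ℝ, 0 ≤ C ∧ ∀ v : E d → E m, (∀ i, MemH10 Ω fun x => v x i) →
      √(nsq Ω v) ≤ C * √(nsq Ω (jac Ω v)) := by
  obtain ⟨C, hC, h⟩ := MemH10.exists_nsq_le hb ⟨0, hd⟩
  refine ⟨√(m * C), by positivity, fun v hv => ?_⟩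
  rw [← Real.sqrt_mul (by positivity)]
  refine Real.sqrt_le_sqrt ?_
  rw [nsq_eq_sum (memLp_of_memH10 hv)]
  calc ∑ i, nsq Ω (fun x => v x i) ≤ ∑ _i : Fin m, C * nsq Ω (jac Ω v) := by
        gcongr with i
        refine (h _ (hv i)).trans ?_
        gcongr
        exact nsq_weakPartial_le_jac (fun i => (hv i).1) i _
    _ = m * C * nsq Ω (jac Ω v) := by simp [mul_assoc]

end Sobolev
-- Curls of spin fields and weak curls of velocities
section Curl

variable {d : ℕ} {Ω : Set (E d)}

theorem ip_sum_mul_left {ι : Type*} (s : Finset ι) (c : ι → ℝ) {f : ι → E d → ℝ} {g : E d → ℝ}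
    (hf : ∀ k, MemLp (f k) 2 (volume.restrict Ω)) (hg : MemLp g 2 (volume.restrict Ω)) :
    ip Ω (fun x => ∑ k ∈ s, c k * f k x) g = ∑ k ∈ s, c k * ip Ω (f k) g := by
  simp only [ip_real, Finset.sum_mul, mul_assoc, ← integral_const_mul]
  exact integral_finsetSum _ fun k _ => ((hf k).integrable_mul hg).const_mul _

/-- This antisymmetry is what makes the curl of a gradient vanish. -/
theorem levi_swap (i j k : ℕ) : levi j i k = - levi i j k := by
  unfold levi
  ring

theorem memLp_levi_left {D : Fin d → Fin (spinDim d) → E d → ℝ}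
    (hD : ∀ j a, MemLp (D j a) 2 (volume.restrict Ω)) :
    MemLp (fun x => (WithLp.toLp 2 fun i : Fin d => ∑ j : Fin d, ∑ a,
      levi i j (axis a) * D j a x : E d)) 2 (volume.restrict Ω) :=
  MemLp.of_eval_piLp fun i => memLp_finsetSum Finset.univ fun j _ =>
    memLp_finsetSum Finset.univ fun a _ => (hD j a).const_mul (levi i j (axis a))

/-- The array `D` is arbitrary so that the formula covers the weak partials in `curlSpin` as well as
the classical ones in `curlTest`. -/
theorem ip_levi_left {D : Fin d → Fin (spinDim d) → E d → ℝ} {v : E d → E d}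
    (hD : ∀ j a, MemLp (D j a) 2 (volume.restrict Ω)) (hv : MemLp v 2 (volume.restrict Ω)) :
    ip Ω (fun x => (WithLp.toLp 2 fun i : Fin d => ∑ j : Fin d, ∑ a,
        levi i j (axis a) * D j a x : E d)) v
      = ∑ i : Fin d, ∑ j : Fin d, ∑ a, levi i j (axis a) * ip Ω (D j a) (fun x => v x i) := by
  rw [ip_eq_sum (memLp_levi_left hD) hv]
  refine Finset.sum_congr rfl fun i _ => ?_
  have h := ip_sum_mul_left (Ω := Ω) Finset.univ (fun _ : Fin d => (1 : ℝ))
    (f := fun j x => ∑ a, levi i j (axis a) * D j a x) (g := fun x => v x i)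
    (fun j => memLp_finsetSum _ fun a _ => (hD j a).const_mul _) (hv.eval_piLp i)
  simp only [one_mul] at h
  rw [h]
  exact Finset.sum_congr rfl fun j _ => ip_sum_mul_left _ _ (hD j) (hv.eval_piLp i)

/-- The sum of the absolute values of the coefficients of the curl. -/
noncomputable def curlBound (d : ℕ) : ℝ :=
  ∑ i : Fin d, ∑ j : Fin d, ∑ a : Fin (spinDim d), |levi i j (axis a)|

theorem curlBound_nonneg (d : ℕ) : 0 ≤ curlBound d :=
  Finset.sum_nonneg fun _ _ => Finset.sum_nonneg fun _ _ => Finset.sum_nonneg fun _ _ =>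
    abs_nonneg _

theorem abs_sum_levi_le {t : Fin d → Fin d → Fin (spinDim d) → ℝ} {B : ℝ}
    (h : ∀ i j a, |t i j a| ≤ B) :
    |∑ i : Fin d, ∑ j : Fin d, ∑ a, levi i j (axis a) * t i j a| ≤ curlBound d * B := by
  simp only [curlBound, Finset.sum_mul]
  refine (Finset.abs_sum_le_sum_abs _ _).trans (Finset.sum_le_sum fun i _ => ?_)
  refine (Finset.abs_sum_le_sum_abs _ _).trans (Finset.sum_le_sum fun j _ => ?_)
  refine (Finset.abs_sum_le_sum_abs _ _).trans (Finset.sum_le_sum fun a _ => ?_)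
  rw [abs_mul]
  exact mul_le_mul_of_nonneg_left (h i j a) (abs_nonneg _)

theorem ip_curlSpin {w : E d → E (spinDim d)} {v : E d → E d}
    (hw : ∀ a, MemH1 Ω fun x => w x a) (hv : MemLp v 2 (volume.restrict Ω)) :
    ip Ω (curlSpin Ω w) v = ∑ i : Fin d, ∑ j : Fin d, ∑ a, levi i j (axis a) *
      ip Ω (weakPartial Ω j fun y => w y a) (fun x => v x i) :=
  ip_levi_left (D := fun j a => weakPartial Ω j fun y => w y a)
    (fun j a => (hw a).memLp_weakPartial j) hv

theorem abs_ip_component_le {m : ℕ} {w : E d → E d} {v : E d → E m}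
    (hw : MemLp w 2 (volume.restrict Ω)) (hv : ∀ i, MemH1 Ω fun x => v x i)
    (i : Fin m) (j a : Fin d) :
    |ip Ω (weakPartial Ω j fun x => v x i) (fun x => w x a)| ≤ √(nsq Ω (jac Ω v)) * √(nsq Ω w) := by
  refine (abs_ip_le ((hv i).memLp_weakPartial j) (hw.eval_piLp a)).trans ?_
  gcongr
  · exact nsq_weakPartial_le_jac hv i j
  · exact nsq_component_le hw a

/-- The curl of a spin field tested with `v ∈ H¹₀(Ω)` is bounded by the gradient of `v`. -/
theorem abs_ip_curlSpin_le {w : E d → E (spinDim d)} {v : E d → E d}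
    (hw : ∀ a, MemH1 Ω fun x => w x a) (hv : ∀ i, MemH10 Ω fun x => v x i) :
    |ip Ω (curlSpin Ω w) v| ≤ curlBound d * (√(nsq Ω (jac Ω v)) * √(nsq Ω w)) := by
  rw [ip_curlSpin hw (memLp_of_memH10 hv)]
  have hw2 : MemLp w 2 (volume.restrict Ω) := MemLp.of_eval_piLp fun a => (hw a).1
  refine abs_sum_levi_le fun i j a => ?_
  -- Integration by parts takes the derivative off `w`, so that only the L² norm of `w` enters the
  -- bound.
  rw [ip_comm, ← abs_neg, ← (hv i).ip_weakPartial (hw a) j]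
  refine (abs_ip_le ((hv i).1.memLp_weakPartial j) (hw2.eval_piLp a)).trans ?_
  gcongr
  · exact nsq_weakPartial_le_jac (fun i => (hv i).1) i j
  · exact nsq_component_le hw2 a

/-- The weak curl may be tested with fields in `H¹₀(Ω)`. -/
theorem HasWeakCurl.ip_eq {u : E d → E d} {c z : E d → E (spinDim d)} (h : HasWeakCurl Ω u c)
    (hu : MemLp u 2 (volume.restrict Ω)) (hz : ∀ a, MemH10 Ω fun x => z x a) :
    ip Ω c z = ip Ω (curlSpin Ω z) u := by
  have hz2 := memLp_of_memH10 hz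
  -- Each component has its own approximating sequence; the n-th members together form a vector test
  -- field.
  choose h1 φ hφ hl hd using hz
  rw [ip_curlSpin h1 hu, ip_comm, ip_eq_sum hz2 h.1]
  have a1 : Tendsto (fun n => ∑ a, ip Ω (φ a n) (fun x => c x a)) atTop
      (𝓝 (∑ a, ip Ω (fun x => z x a) (fun x => c x a))) :=
    tendsto_finsetSum _ fun a _ =>
      tendsto_ip (h1 a).1 (fun n => (hφ a n).memLp) (h.1.eval_piLp a) (hl a)
  have a2 : Tendsto (fun n => ∑ i : Fin d, ∑ j : Fin d, ∑ a, levi i j (axis a) *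
      ip Ω (pderiv j (φ a n)) (fun x => u x i)) atTop
      (𝓝 (∑ i : Fin d, ∑ j : Fin d, ∑ a, levi i j (axis a) *
        ip Ω (weakPartial Ω j fun y => z y a) (fun x => u x i))) :=
    tendsto_finsetSum _ fun i _ => tendsto_finsetSum _ fun j _ => tendsto_finsetSum _ fun a _ =>
      (tendsto_ip ((h1 a).memLp_weakPartial j) (fun n => ((hφ a n).pderiv j).memLp)
        (hu.eval_piLp i) (hd a j)).const_mul _
  refine tendsto_nhds_unique a1 (a2.congr fun n => ?_)
  have e := h.2 (fun x => WithLp.toLp 2 fun a => φ a n x) fun a => hφ a n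
  rw [ip_comm, ip_comm u, ip_eq_sum (MemLp.of_eval_piLp fun a => (hφ a n).memLp) h.1] at e
  exact (ip_levi_left (D := fun j a => pderiv j (φ a n))
    (fun j a => ((hφ a n).pderiv j).memLp) hu).symm.trans e.symm

/-- The weak curl of `u` tested with `z ∈ H¹₀(Ω)` is bounded by the gradient of `z`. -/
theorem abs_ip_curl_le {u : E d → E d} {z : E d → E (spinDim d)} (h : ∃ c, HasWeakCurl Ω u c)
    (hu : MemLp u 2 (volume.restrict Ω)) (hz : ∀ a, MemH10 Ω fun x => z x a) :
    |ip Ω (curl Ω u) z| ≤ curlBound d * (√(nsq Ω (jac Ω z)) * √(nsq Ω u)) := by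
  rw [curl, dif_pos h, h.choose_spec.ip_eq hu hz, ip_curlSpin (fun a => (hz a).1) hu]
  exact abs_sum_levi_le fun i j a => abs_ip_component_le hu (fun a => (hz a).1) a j i

theorem HasWeakCurl.congr_ae {u v : E d → E d} {c : E d → E (spinDim d)} (h : HasWeakCurl Ω u c)
    (huv : v =ᵐ[volume.restrict Ω] u) : HasWeakCurl Ω v c :=
  ⟨h.1, fun φ hφ => by rw [ip_congr_ae huv]; exact h.2 φ hφ⟩

theorem memLp_curlTest {φ : E d → E (spinDim d)} (hφ : ∀ a, IsTest Ω fun x => φ x a) :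
    MemLp (curlTest φ) 2 (volume.restrict Ω) :=
  memLp_levi_left (D := fun j a => pderiv j fun y => φ y a) fun j a => ((hφ a).pderiv j).memLp

theorem memLp_of_isTest {m : ℕ} {φ : E d → E m} (hφ : ∀ a, IsTest Ω fun x => φ x a) :
    MemLp φ 2 (volume.restrict Ω) :=
  MemLp.of_eval_piLp fun a => (hφ a).memLp

theorem HasWeakCurl.add {u v : E d → E d} {b c : E d → E (spinDim d)}
    (hu : MemLp u 2 (volume.restrict Ω)) (hv : MemLp v 2 (volume.restrict Ω))
    (h : HasWeakCurl Ω u b) (h' : HasWeakCurl Ω v c) :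
    HasWeakCurl Ω (fun x => u x + v x) (fun x => b x + c x) := by
  refine ⟨h.1.add h'.1, fun φ hφ => ?_⟩
  rw [ip_add_left h.1 h'.1 (memLp_of_isTest hφ), ip_add_left hu hv (memLp_curlTest hφ), h.2 φ hφ,
    h'.2 φ hφ]

theorem HasWeakCurl.smul {u : E d → E d} {b : E d → E (spinDim d)} (h : HasWeakCurl Ω u b)
    (c : ℝ) : HasWeakCurl Ω (fun x => c • u x) (fun x => c • b x) :=
  ⟨h.1.const_smul c, fun φ hφ => by rw [ip_smul_left, ip_smul_left, h.2 φ hφ]⟩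

/-- A gradient has weak curl zero. -/
theorem hasWeakCurl_grad {q : E d → ℝ} (hq : MemH1 Ω q) : HasWeakCurl Ω (grad Ω q) 0 := by
  refine ⟨MemLp.zero, fun φ hφ => ?_⟩
  have h0 : ip Ω (0 : E d → E (spinDim d)) φ = 0 := by simp [ip]
  have e : ip Ω (curlTest φ) (grad Ω q) = ∑ i : Fin d, ∑ j : Fin d, ∑ a, levi i j (axis a) *
      ip Ω (pderiv j fun y => φ y a) (fun x => grad Ω q x i) :=
    ip_levi_left (D := fun j a => pderiv j fun y => φ y a)
      (fun j a => ((hφ a).pderiv j).memLp) hq.memLp_grad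
  -- The partial derivative of a test function is again a test function, so it may be inserted in
  -- the definition of the weak gradient of `q`.
  have t : ∀ (i j : Fin d) (a : Fin (spinDim d)),
      ip Ω (pderiv j fun y => φ y a) (fun x => grad Ω q x i)
        = - ∫ x in Ω, q x * pderiv i (pderiv j fun y => φ y a) x := by
    intro i j a
    rw [(hq.weakPartial i).2 _ ((hφ a).pderiv j), neg_neg, ip_comm, ip_real]
    rfl
  have sym : ∀ (i j : Fin d) (a : Fin (spinDim d)),
      pderiv i (pderiv j fun y => φ y a) = pderiv j (pderiv i fun y => φ y a) := by
    intro i j a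
    ext x
    have hs : IsSymmSndFDerivAt ℝ (fun y => φ y a) x :=
      (hφ a).1.contDiffAt.isSymmSndFDerivAt
        (by simpa using WithTop.coe_le_coe.2 (le_top : (2 : ℕ∞) ≤ ⊤))
    have hf : DifferentiableAt ℝ (fderiv ℝ fun y => φ y a) x :=
      ((hφ a).1.fderiv_right (m := ∞) (by simp)).differentiable (by simp) x
    have hp : ∀ k l : Fin d, pderiv k (pderiv l fun y => φ y a) x =
        fderiv ℝ (fderiv ℝ fun y => φ y a) x (EuclideanSpace.single k 1)
          (EuclideanSpace.single l 1) := by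
      intro k l
      unfold pderiv
      rw [fderiv_clm_apply hf (by fun_prop)]
      simp
    rw [hp, hp, hs]
  rw [h0, ip_comm, e]
  simp only [t]
  set t' : Fin d → Fin d → Fin (spinDim d) → ℝ :=
    fun i j a => - ∫ x in Ω, q x * pderiv i (pderiv j fun y => φ y a) x with ht'
  -- Exchanging `i` and `j` changes the sign of the Levi-Civita symbol and leaves the second
  -- derivatives of φ unchanged, so the sum equals its own negative.
  have hS : ∑ i : Fin d, ∑ j : Fin d, ∑ a, levi i j (axis a) * t' i j a
      = - ∑ i : Fin d, ∑ j : Fin d, ∑ a, levi i j (axis a) * t' i j a := by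
    conv_lhs => rw [Finset.sum_comm]
    simp only [← Finset.sum_neg_distrib]
    refine Finset.sum_congr rfl fun i _ => Finset.sum_congr rfl fun j _ =>
      Finset.sum_congr rfl fun a _ => ?_
    rw [levi_swap, ht']
    simp only [sym j i a]
    ring
  linarith

/-- A field with components in `H¹(Ω)` has a weak curl. -/
theorem exists_hasWeakCurl_of_memH1 {v : E d → E d} (hv : ∀ i, MemH1 Ω fun x => v x i) :
    ∃ c, HasWeakCurl Ω v c := by
  have hv2 : MemLp v 2 (volume.restrict Ω) := MemLp.of_eval_piLp fun i => (hv i).1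
  have hc : ∀ a : Fin (spinDim d), MemLp (fun x => ∑ i : Fin d, ∑ j : Fin d,
      (- levi i j (axis a)) * weakPartial Ω j (fun y => v y i) x) 2 (volume.restrict Ω) :=
    fun a => memLp_finsetSum _ fun i _ => memLp_finsetSum _ fun j _ =>
      ((hv i).memLp_weakPartial j).const_mul _
  -- The minus sign comes from the integration by parts. Since -ε_{ija} = ε_{aji}, this is the usual
  -- curl.
  refine ⟨fun x => WithLp.toLp 2 fun a => ∑ i : Fin d, ∑ j : Fin d,
    (- levi i j (axis a)) * weakPartial Ω j (fun y => v y i) x, MemLp.of_eval_piLp hc,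
    fun φ hφ => ?_⟩
  have e : ip Ω (curlTest φ) v = ∑ i : Fin d, ∑ j : Fin d, ∑ a, levi i j (axis a) *
      ip Ω (pderiv j fun y => φ y a) (fun x => v x i) :=
    ip_levi_left (D := fun j a => pderiv j fun y => φ y a)
      (fun j a => ((hφ a).pderiv j).memLp) hv2
  rw [ip_comm v, e, ip_eq_sum (MemLp.of_eval_piLp hc) (memLp_of_isTest hφ)]
  have s : ∀ a : Fin (spinDim d), ip Ω (fun x => ∑ i : Fin d, ∑ j : Fin d,
      (- levi i j (axis a)) * weakPartial Ω j (fun y => v y i) x) (fun x => φ x a)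
      = ∑ i : Fin d, ∑ j : Fin d, (- levi i j (axis a)) *
        ip Ω (weakPartial Ω j fun y => v y i) (fun x => φ x a) := by
    intro a
    have h := ip_sum_mul_left (Ω := Ω) Finset.univ (fun _ : Fin d => (1 : ℝ))
      (f := fun i x => ∑ j : Fin d, (- levi i j (axis a)) * weakPartial Ω j (fun y => v y i) x)
      (g := fun x => φ x a)
      (fun i => memLp_finsetSum _ fun j _ => ((hv i).memLp_weakPartial j).const_mul _)
      (hφ a).memLp
    simp only [one_mul] at h
    rw [h]
    exact Finset.sum_congr rfl fun i _ => ip_sum_mul_left _ _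
      (fun j => (hv i).memLp_weakPartial j) (hφ a).memLp
  simp only [s]
  rw [Finset.sum_comm]
  refine Finset.sum_congr rfl fun i _ => ?_
  rw [Finset.sum_comm]
  refine Finset.sum_congr rfl fun j _ => Finset.sum_congr rfl fun a _ => ?_
  rw [ip_comm (pderiv j _), ip_real (fun x => v x i), ((hv i).weakPartial j).2 _ (hφ a), ← ip_real]
  ring

end Curl

/-! ### Energy identities in a Hilbert space -/

section Hilbert

variable {H : Type*} [NormedAddCommGroup H] [InnerProductSpace ℝ H]

/-- The energy identity of the second-order backward difference formula. -/
theorem bdf2_energy {a b c : H} {δ ζ A R : ℝ} (hδ : 0 < δ)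
    (h : ζ * inner ℝ ((2 * δ)⁻¹ • ((3 : ℝ) • a - (4 : ℝ) • b + c)) a + A = R) :
    ζ * (‖a‖ ^ 2 + ‖(2 : ℝ) • a - b‖ ^ 2 + ‖a - (2 : ℝ) • b + c‖ ^ 2) + 4 * δ * A
      = ζ * (‖b‖ ^ 2 + ‖(2 : ℝ) • b - c‖ ^ 2) + 4 * δ * R := by
  subst h
  simp only [← real_inner_self_eq_norm_sq, inner_add_left, inner_sub_left, inner_add_right,
    inner_sub_right, real_inner_smul_left, real_inner_smul_right, real_inner_comm a b,
    real_inner_comm a c, real_inner_comm b c]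
  field_simp
  ring

/-- The energy identity of the implicit Euler method, with the dissipative term dropped. -/
theorem euler_energy {a b : H} {δ ζ A R : ℝ} (hδ : 0 < δ) (hζ : 0 ≤ ζ)
    (h : ζ * inner ℝ (δ⁻¹ • (a - b)) a + A = R) :
    ζ * ‖a‖ ^ 2 + 2 * δ * A ≤ ζ * ‖b‖ ^ 2 + 2 * δ * R := by
  subst h
  have h1 : 0 ≤ ζ * ‖a - b‖ ^ 2 := by positivity
  have h2 : ζ * ‖b‖ ^ 2 + 2 * δ * (ζ * inner ℝ (δ⁻¹ • (a - b)) a + A)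
      = ζ * ‖a‖ ^ 2 + 2 * δ * A + ζ * ‖a - b‖ ^ 2 := by
    simp only [← real_inner_self_eq_norm_sq, inner_sub_left, inner_sub_right,
      real_inner_smul_left, real_inner_comm a b]
    field_simp
    ring
  linarith

/-- The energy inequality of the second-order pressure projection step: `v` is the predicted and
`a` the projected velocity, `g` and `f` are the new and the old pressure gradient. -/
theorem bdf2_projection_energy {v a b c g f : H} {δ A R : ℝ} (hδ : 0 < δ)
    (h : inner ℝ ((2 * δ)⁻¹ • ((3 : ℝ) • v - (4 : ℝ) • b + c)) v + A + inner ℝ f v = R)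
    (hv : a = v - (2 * δ / 3) • g + (2 * δ / 3) • f)
    (hag : inner ℝ a g = 0) (haf : inner ℝ a f = 0) (hbg : inner ℝ b g = 0)
    (hbf : inner ℝ b f = 0) (hcg : inner ℝ c g = 0) (hcf : inner ℝ c f = 0) :
    ‖a‖ ^ 2 + ‖(2 : ℝ) • a - b‖ ^ 2 + ‖a - (2 : ℝ) • b + c‖ ^ 2 + 4 * δ ^ 2 / 3 * ‖g‖ ^ 2
        + 4 * δ * A
      ≤ ‖b‖ ^ 2 + ‖(2 : ℝ) • b - c‖ ^ 2 + 4 * δ ^ 2 / 3 * ‖f‖ ^ 2 + 4 * δ * R := by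
  obtain rfl : v = a + (2 * δ / 3) • g - (2 * δ / 3) • f := by rw [hv]; abel
  subst h
  -- The pressure terms add up to (8δ²/3)(g - f, g) = (4δ²/3)(‖g‖² - ‖f‖² + ‖g - f‖²); the last
  -- square is the only loss.
  have h1 : 0 ≤ 4 * δ ^ 2 / 3 * ‖g - f‖ ^ 2 := by positivity
  refine le_of_sub_nonneg (h1.trans_eq ?_)
  simp only [← real_inner_self_eq_norm_sq, inner_add_left, inner_sub_left, inner_add_right,
    inner_sub_right, real_inner_smul_left, real_inner_smul_right, real_inner_comm a b,
    real_inner_comm a c, real_inner_comm b c, real_inner_comm a g, real_inner_comm a f,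
    real_inner_comm g f]
  simp only [hag, haf, hbg, hbf, hcg, hcf]
  field_simp
  ring

/-- The energy inequality of the first-order pressure projection step. -/
theorem euler_projection_energy {v a b g f : H} {δ A R : ℝ} (hδ : 0 < δ)
    (h : inner ℝ (δ⁻¹ • (v - b)) v + A + inner ℝ f v = R)
    (hv : a = v - δ • g + δ • f)
    (hag : inner ℝ a g = 0) (haf : inner ℝ a f = 0) (hbg : inner ℝ b g = 0)
    (hbf : inner ℝ b f = 0) :
    ‖a‖ ^ 2 + 4 * δ ^ 2 / 3 * ‖g‖ ^ 2 + 2 * δ * A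
      ≤ ‖b‖ ^ 2 + 3 * δ ^ 2 / 2 * ‖f‖ ^ 2 + 2 * δ * R := by
  obtain rfl : v = a + δ • g - δ • f := by rw [hv]; abel
  subst h
  -- Here the pressure terms add up to 2δ²(‖g‖² - (g, f)). Keeping 4/3 of ‖g‖², as the second-order
  -- steps require, and completing the square with the other 2/3 costs 3/2 of ‖f‖².
  have h1 : 0 ≤ ‖a - b‖ ^ 2 + δ ^ 2 / 6 * ‖(2 : ℝ) • g - (3 : ℝ) • f‖ ^ 2 := by positivity
  refine le_of_sub_nonneg (h1.trans_eq ?_)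
  simp only [← real_inner_self_eq_norm_sq, inner_add_left, inner_sub_left, inner_add_right,
    inner_sub_right, real_inner_smul_left, real_inner_smul_right, real_inner_comm a b,
    real_inner_comm a g, real_inner_comm a f,
    real_inner_comm g f]
  simp only [hag, haf, hbg, hbf]
  field_simp
  ring

end Hilbert

/-! ### Bounds on the sources and regularity of the time levels -/

section Scheme

variable {d : ℕ} {Ω : Set (E d)}

/-- The two halves are the same number, so no condition on the divergence of `w` and no
integrability is needed. -/
theorem bForm_self {m : ℕ} (w : E d → E d) (a : E d → E m) : bForm Ω w a a = 0 :=
  sub_self _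

theorem bFormS_self (w : E d → E d) (f : E d → ℝ) : bFormS Ω w f f = 0 :=
  sub_self _

/-- The weight is α/4 because the momentum equation has two source terms, which together may use
half of the dissipation. -/
theorem mul_mul_le_young {α M x y : ℝ} (hα : 0 < α) :
    M * (y * x) ≤ α / 4 * y ^ 2 + M ^ 2 / α * x ^ 2 := by
  have h : 0 ≤ (α / 2 * y - M * x) ^ 2 / α := by positivity
  have e : (α / 2 * y - M * x) ^ 2 / α
      = α / 4 * y ^ 2 + M ^ 2 / α * x ^ 2 - M * (y * x) := by
    field_simp
    ring
  linarith

theorem nsq_smul_const {m : ℕ} (f : E d → ℝ) (e : E m) :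
    nsq Ω (fun x => f x • e) = nsq Ω f * ‖e‖ ^ 2 := by
  simp only [nsq, norm_smul, mul_pow, integral_mul_const]

theorem nsq_inner_const_le {m : ℕ} {u : E d → E m} (hu : MemLp u 2 (volume.restrict Ω))
    (e : E m) : nsq Ω (fun x => inner ℝ (u x) e) ≤ ‖e‖ ^ 2 * nsq Ω u := by
  rw [nsq, nsq, ← integral_const_mul]
  refine integral_mono (hu.inner_const e).norm.integrable_sq (hu.norm.integrable_sq.const_mul _)
    fun x => ?_
  rw [mul_comm, ← mul_pow]
  exact pow_le_pow_left₀ (norm_nonneg _) (norm_inner_le_norm _ _) 2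

/-- The bounds on the right-hand sides of the three equations by half of the dissipation and by
`C` times the squared norms of the data. -/
def SourceBound (Ω : Set (E d)) (P : Params) (C : ℝ) (u : E d → E d) (w : E d → E (spinDim d))
    (θ : E d → ℝ) : Prop :=
  (∀ v : E d → E d, (∀ i, MemH10 Ω fun x => v x i) →
    2 * P.chi * ip Ω (curlSpin Ω w) v + ip Ω (fun x => θ x • vert d) v
      ≤ (P.chi + P.mu) / 2 * nsq Ω (jac Ω v) + C * (nsq Ω u + nsq Ω w + nsq Ω θ)) ∧
  (∀ z : E d → E (spinDim d), (∀ a, MemH10 Ω fun x => z x a) →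
    2 * P.chi * ip Ω (curl Ω u) z
      ≤ P.ups / 2 * nsq Ω (jac Ω z) + C * (nsq Ω u + nsq Ω w + nsq Ω θ)) ∧
  (∀ g : E d → ℝ, MemH10 Ω g →
    ip Ω (fun x => inner ℝ (u x) (vert d)) g
      ≤ P.kappa / 2 * nsq Ω (grad Ω g) + C * (nsq Ω u + nsq Ω w + nsq Ω θ))

/-- The right-hand sides of the three equations, tested with fields in `H¹₀(Ω)`, are controlled by
half of the dissipation and by the squared norms of the data. -/
theorem exists_source_le (hd : 0 < d) (hb : ∃ R : ℝ, ∀ x ∈ Ω, ‖x‖ ≤ R) (P : Params) :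
    ∃ C : ℝ, 0 < C ∧ ∀ (u : E d → E d) (w : E d → E (spinDim d)) (θ : E d → ℝ),
      MemLp u 2 (volume.restrict Ω) → (∃ c, HasWeakCurl Ω u c) →
      (∀ a, MemH1 Ω fun x => w x a) → MemLp θ 2 (volume.restrict Ω) →
      SourceBound Ω P C u w θ := by
  obtain ⟨cv, hcv, hv⟩ := exists_poincare_vector hd hb d
  obtain ⟨cs, hcs, hs⟩ := exists_poincare_scalar hd hb
  set K := curlBound d
  have hK : 0 ≤ K := curlBound_nonneg d
  have hχ := P.chi_pos
  have hμ := P.mu_pos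
  have hυ := P.ups_pos
  have hκ := P.kappa_pos
  set e := ‖vert d‖
  have he : 0 ≤ e := norm_nonneg _
  have hα : 0 < P.chi + P.mu := by positivity
  set M₁ := 2 * P.chi * K
  have hM₁ : 0 ≤ M₁ := by positivity
  set M₂ := e * cv
  set M₃ := e * cs
  -- The sum of the four Young constants (two in the momentum equation, one each for spin and
  -- temperature) serves all three bounds; the 1 makes it positive.
  refine ⟨M₁ ^ 2 / (P.chi + P.mu) + M₂ ^ 2 / (P.chi + P.mu) + M₁ ^ 2 / P.ups + M₃ ^ 2 / P.kappa + 1,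
    by positivity, fun u w θ hu hcurl hw hθ => ?_⟩
  have hw2 : MemLp w 2 (volume.restrict Ω) := MemLp.of_eval_piLp fun a => (hw a).1
  have nu := nsq_nonneg (Ω := Ω) u
  have nw := nsq_nonneg (Ω := Ω) w
  have nθ := nsq_nonneg (Ω := Ω) θ
  have q₁ : 0 ≤ M₁ ^ 2 / (P.chi + P.mu) := by positivity
  have q₂ : 0 ≤ M₂ ^ 2 / (P.chi + P.mu) := by positivity
  have q₃ : 0 ≤ M₁ ^ 2 / P.ups := by positivity
  have q₄ : 0 ≤ M₃ ^ 2 / P.kappa := by positivity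
  refine ⟨fun v hv' => ?_, fun z hz => ?_, fun g hg => ?_⟩
  · have a1 : 2 * P.chi * ip Ω (curlSpin Ω w) v ≤ M₁ * (√(nsq Ω (jac Ω v)) * √(nsq Ω w)) := by
      rw [mul_assoc (2 * P.chi)]
      exact mul_le_mul_of_nonneg_left ((le_abs_self _).trans (abs_ip_curlSpin_le hw hv'))
        (by positivity)
    have a2 : ip Ω (fun x => θ x • vert d) v ≤ M₂ * (√(nsq Ω (jac Ω v)) * √(nsq Ω θ)) := by
      have hm : MemLp (fun x => θ x • vert d) 2 (volume.restrict Ω) :=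
        MemLp.of_eval_piLp fun i => hθ.mul_const (vert d i)
      refine (le_abs_self _).trans ((abs_ip_le hm (memLp_of_memH10 hv')).trans ?_)
      rw [nsq_smul_const, Real.sqrt_mul nθ, Real.sqrt_sq he]
      calc √(nsq Ω θ) * e * √(nsq Ω v) ≤ √(nsq Ω θ) * e * (cv * √(nsq Ω (jac Ω v))) := by
            gcongr
            exact hv v hv'
        _ = M₂ * (√(nsq Ω (jac Ω v)) * √(nsq Ω θ)) := by ring
    have y1 := mul_mul_le_young (M := M₁) (x := √(nsq Ω w)) (y := √(nsq Ω (jac Ω v))) hα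
    have y2 := mul_mul_le_young (M := M₂) (x := √(nsq Ω θ)) (y := √(nsq Ω (jac Ω v))) hα
    rw [Real.sq_sqrt (nsq_nonneg _), Real.sq_sqrt (nsq_nonneg _)] at y1 y2
    -- The listed products are the terms of C(‖u‖² + ‖w‖² + ‖θ‖²) that this bound does not need.
    nlinarith [mul_nonneg q₁ nu, mul_nonneg q₁ nθ, mul_nonneg q₂ nu, mul_nonneg q₂ nw,
      mul_nonneg q₃ nu, mul_nonneg q₃ nw, mul_nonneg q₃ nθ, mul_nonneg q₄ nu, mul_nonneg q₄ nw,
      mul_nonneg q₄ nθ]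
  · have a1 : 2 * P.chi * ip Ω (curl Ω u) z ≤ M₁ * (√(nsq Ω (jac Ω z)) * √(nsq Ω u)) := by
      rw [mul_assoc (2 * P.chi)]
      exact mul_le_mul_of_nonneg_left ((le_abs_self _).trans (abs_ip_curl_le hcurl hu hz))
        (by positivity)
    have y1 := mul_mul_le_young (M := M₁) (x := √(nsq Ω u)) (y := √(nsq Ω (jac Ω z))) hυ
    rw [Real.sq_sqrt (nsq_nonneg _), Real.sq_sqrt (nsq_nonneg _)] at y1
    nlinarith [mul_nonneg q₁ nu, mul_nonneg q₁ nw, mul_nonneg q₁ nθ, mul_nonneg q₂ nu,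
      mul_nonneg q₂ nw, mul_nonneg q₂ nθ, mul_nonneg q₃ nw, mul_nonneg q₃ nθ, mul_nonneg q₄ nu,
      mul_nonneg q₄ nw, mul_nonneg q₄ nθ, mul_nonneg hυ.le (nsq_nonneg (Ω := Ω) (jac Ω z))]
  · have a1 : ip Ω (fun x => inner ℝ (u x) (vert d)) g
        ≤ M₃ * (√(nsq Ω (grad Ω g)) * √(nsq Ω u)) := by
      refine (le_abs_self _).trans ((abs_ip_le (hu.inner_const _) hg.1.1).trans ?_)
      have h1 : √(nsq Ω fun x => inner ℝ (u x) (vert d)) ≤ e * √(nsq Ω u) := by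
        refine (Real.sqrt_le_sqrt (nsq_inner_const_le hu (vert d))).trans_eq ?_
        rw [Real.sqrt_mul (by positivity), Real.sqrt_sq he]
      calc _ ≤ e * √(nsq Ω u) * (cs * √(nsq Ω (grad Ω g))) := by
            gcongr
            exact hs g hg
        _ = M₃ * (√(nsq Ω (grad Ω g)) * √(nsq Ω u)) := by ring
    have y1 := mul_mul_le_young (M := M₃) (x := √(nsq Ω u)) (y := √(nsq Ω (grad Ω g))) hκ
    rw [Real.sq_sqrt (nsq_nonneg _), Real.sq_sqrt (nsq_nonneg _)] at y1
    nlinarith [mul_nonneg q₁ nu, mul_nonneg q₁ nw, mul_nonneg q₁ nθ, mul_nonneg q₂ nu,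
      mul_nonneg q₂ nw, mul_nonneg q₂ nθ, mul_nonneg q₃ nu, mul_nonneg q₃ nw, mul_nonneg q₃ nθ,
      mul_nonneg q₄ nw, mul_nonneg q₄ nθ, mul_nonneg hκ.le (nsq_nonneg (Ω := Ω) (grad Ω g))]

variable {T : Triangulation Ω} {P : Params} {k l r s : ℕ} {δ : ℝ} {S : Fields d}

/-- The properties of the fields at a time level that the energy estimate uses. -/
structure IsRegularLevel (T : Triangulation Ω) (l r s : ℕ) (S : Fields d) (n : ℕ) : Prop where
  u_memLp : MemLp (S.u n) 2 (volume.restrict Ω)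
  u_curl : ∃ c, HasWeakCurl Ω (S.u n) c
  u_div : WeaklyDivFree T l (S.u n)
  p_mem : PressureFE T l (S.p n)
  w_mem : VectorFE T r (S.w n)
  th_mem : ScalarFE T s (S.th n)

theorem VectorFE.memH10 {m : ℕ} {v : E d → E m} (h : VectorFE T k v) (i : Fin m) :
    MemH10 Ω fun x => v x i :=
  (h i).2

/-- The H¹₀ part supplies the weak curl; the gradient part contributes zero. -/
theorem IsStart.isRegularLevel {n : ℕ} (h : IsStart T k l r s S n) :
    IsRegularLevel T l r s S n := by
  obtain ⟨v, q, hv, hq, he⟩ := h.u_mem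
  have hv2 := memLp_of_memH10 hv.memH10
  have hq2 := hq.2.1.memLp_grad
  obtain ⟨c, hc⟩ := exists_hasWeakCurl_of_memH1 fun i => (hv.memH10 i).1
  exact ⟨(hv2.add hq2).ae_eq (EventuallyEq.symm he),
    ⟨_, (hc.add hv2 hq2 (hasWeakCurl_grad hq.2.1)).congr_ae he⟩, h.u_div, h.p_mem, h.w_mem,
    h.th_mem⟩

/-- The velocity produced by a projection step is square integrable, has a weak curl and is weakly
divergence free. -/
theorem projection_regular {v a : E d → E d} {p q : E d → ℝ} {σ ρ : ℝ} (hσ : σ * ρ = 1)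
    (hv : VectorFE T k v) (hp : PressureFE T l p) (hq : PressureFE T l q)
    (he : ∀ᵐ x ∂volume.restrict Ω, a x = v x - σ • grad Ω p x + σ • grad Ω q x)
    (hpr : ∀ g, PressureFE T l g → ip Ω (grad Ω p) (grad Ω g)
      = - ρ * ip Ω (divg Ω v) g + ip Ω (grad Ω q) (grad Ω g)) :
    MemLp a 2 (volume.restrict Ω) ∧ (∃ c, HasWeakCurl Ω a c) ∧ WeaklyDivFree T l a := by
  have hv2 := memLp_of_memH10 hv.memH10
  have hp2 := hp.2.1.memLp_grad
  have hq2 := hq.2.1.memLp_grad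
  have he' : a =ᵐ[volume.restrict Ω]
      fun x => (v x + (-σ) • grad Ω p x) + σ • grad Ω q x := by
    filter_upwards [he] with x hx
    rw [hx, neg_smul, sub_eq_add_neg]
  have hm1 : MemLp (fun x => (-σ) • grad Ω p x) 2 (volume.restrict Ω) := hp2.const_smul (-σ)
  have hm2 : MemLp (fun x => σ • grad Ω q x) 2 (volume.restrict Ω) := hq2.const_smul σ
  have hm12 : MemLp (fun x => v x + (-σ) • grad Ω p x) 2 (volume.restrict Ω) := hv2.add hm1
  obtain ⟨c, hc⟩ := exists_hasWeakCurl_of_memH1 fun i => (hv.memH10 i).1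
  refine ⟨(hm12.add hm2).ae_eq he'.symm, ⟨_, ((hc.add hv2 hm1
    ((hasWeakCurl_grad hp.2.1).smul _)).add hm12 hm2 ((hasWeakCurl_grad hq.2.1).smul _)).congr_ae
      he'⟩, fun g hg => ?_⟩
  have hg2 := hg.2.1.memLp_grad
  -- No boundary term appears, since `v` has components in H¹₀(Ω).
  have hdiv : ip Ω (divg Ω v) g = - ip Ω v (grad Ω g) := by
    have h := ip_sum_mul_left (Ω := Ω) Finset.univ (fun _ : Fin d => (1 : ℝ))
      (f := fun i => weakPartial Ω i fun y => v y i) (g := g)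
      (fun i => (hv.memH10 i).1.memLp_weakPartial i) hg.2.1.1
    simp only [one_mul] at h
    refine h.trans ?_
    rw [ip_eq_sum hv2 hg2, ← Finset.sum_neg_distrib]
    exact Finset.sum_congr rfl fun i _ => (hv.memH10 i).ip_weakPartial hg.2.1 i
  rw [ip_congr_ae he', ip_add_left hm12 hm2 hg2, ip_add_left hv2 hm1 hg2, ip_smul_left,
    ip_smul_left, hpr g hg, hdiv]
  -- The pressure equation turns (a, ∇g) into (1 - σρ)(v, ∇g); the condition σρ = 1 covers both the
  -- second-order and the starting step.
  linear_combination (- ip Ω v (grad Ω g)) * hσ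

theorem IsStep.isRegularLevel (hδ : 0 < δ) {n : ℕ} (h : IsStep P T k l r s δ S n)
    (h0 : IsRegularLevel T l r s S n) : IsRegularLevel T l r s S (n + 1) := by
  obtain ⟨h1, h2, h3⟩ := projection_regular (σ := 2 * δ / 3) (ρ := 3 / (2 * δ))
    (by field_simp) h.ut_mem h.p_mem h0.p_mem h.velocity h.pressure
  exact ⟨h1, h2, h3, h.p_mem, h.w_mem, h.th_mem⟩

theorem IsFirstStep.isRegularLevel (hδ : 0 < δ) (h : IsFirstStep P T k l r s δ S)
    (h0 : IsRegularLevel T l r s S 0) : IsRegularLevel T l r s S 1 := by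
  obtain ⟨h1, h2, h3⟩ := projection_regular (σ := δ) (ρ := 1 / δ)
    (by field_simp) h.ut_mem h.p_mem h0.p_mem h.velocity h.pressure
  exact ⟨h1, h2, h3, h.p_mem, h.w_mem, h.th_mem⟩

theorem IsRegularLevel.extrap_u {n : ℕ} (h0 : IsRegularLevel T l r s S n)
    (h1 : IsRegularLevel T l r s S (n + 1)) :
    MemLp (extrap S.u (n + 1)) 2 (volume.restrict Ω) ∧
      ∃ c, HasWeakCurl Ω (extrap S.u (n + 1)) c := by
  obtain ⟨c, hc⟩ := h0.u_curl
  obtain ⟨c', hc'⟩ := h1.u_curl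
  have m1 : MemLp (fun x => (2 : ℝ) • S.u (n + 1) x) 2 (volume.restrict Ω) :=
    h1.u_memLp.const_smul (2 : ℝ)
  have m0 : MemLp (fun x => (-1 : ℝ) • S.u n x) 2 (volume.restrict Ω) := 
    h0.u_memLp.const_smul (-1 : ℝ)
  refine ⟨m1.sub h0.u_memLp, _, ((hc'.smul 2).add m1 m0 (hc.smul (-1))).congr_ae
    (Eventually.of_forall fun x => ?_)⟩
  simp [extrap, sub_eq_add_neg]

theorem IsRegularLevel.extrap_w {n : ℕ} (h0 : IsRegularLevel T l r s S n)
    (h1 : IsRegularLevel T l r s S (n + 1)) (a : Fin (spinDim d)) :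
    MemH1 Ω fun x => extrap S.w (n + 1) x a :=
  (h1.w_mem.memH10 a).1.sub_smul (h0.w_mem.memH10 a).1 2

theorem IsRegularLevel.extrap_th {n : ℕ} (h0 : IsRegularLevel T l r s S n)
    (h1 : IsRegularLevel T l r s S (n + 1)) :
    MemLp (extrap S.th (n + 1)) 2 (volume.restrict Ω) :=
  (h1.th_mem.2.1.1.const_smul (2 : ℝ)).sub h0.th_mem.2.1.1

end Scheme

/-! ### The energy identities for square integrable fields -/

section Fields

variable {d : ℕ} {Ω : Set (E d)} {F : Type*} [NormedAddCommGroup F] [InnerProductSpace ℝ F]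

theorem bdf2_energy_fields {a b c : E d → F} {δ ζ A R : ℝ} (hδ : 0 < δ)
    (ha : MemLp a 2 (volume.restrict Ω)) (hb : MemLp b 2 (volume.restrict Ω))
    (hc : MemLp c 2 (volume.restrict Ω))
    (h : ζ * ip Ω (fun x => (2 * δ)⁻¹ • ((3 : ℝ) • a x - (4 : ℝ) • b x + c x)) a + A = R) :
    ζ * (nsq Ω a + nsq Ω (fun x => (2 : ℝ) • a x - b x)
        + nsq Ω (fun x => a x - (2 : ℝ) • b x + c x)) + 4 * δ * A
      = ζ * (nsq Ω b + nsq Ω (fun x => (2 : ℝ) • b x - c x)) + 4 * δ * R := by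
  -- The class of a pointwise linear combination is by definition the linear combination of the
  -- classes.
  have e0 : ip Ω (fun x => (2 * δ)⁻¹ • ((3 : ℝ) • a x - (4 : ℝ) • b x + c x)) a
      = inner ℝ ((2 * δ)⁻¹ • ((3 : ℝ) • ha.toLp a - (4 : ℝ) • hb.toLp b + hc.toLp c))
        (ha.toLp a) :=
    ip_eq_inner ((((ha.const_smul (3 : ℝ)).sub (hb.const_smul (4 : ℝ))).add hc).const_smul
      (2 * δ)⁻¹) ha
  have e1 : nsq Ω (fun x => (2 : ℝ) • a x - b x) = ‖(2 : ℝ) • ha.toLp a - hb.toLp b‖ ^ 2 :=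
    nsq_eq_norm_sq ((ha.const_smul (2 : ℝ)).sub hb)
  have e2 : nsq Ω (fun x => (2 : ℝ) • b x - c x) = ‖(2 : ℝ) • hb.toLp b - hc.toLp c‖ ^ 2 :=
    nsq_eq_norm_sq ((hb.const_smul (2 : ℝ)).sub hc)
  have e3 : nsq Ω (fun x => a x - (2 : ℝ) • b x + c x)
      = ‖ha.toLp a - (2 : ℝ) • hb.toLp b + hc.toLp c‖ ^ 2 :=
    nsq_eq_norm_sq ((ha.sub (hb.const_smul (2 : ℝ))).add hc)
  rw [e1, e2, e3, nsq_eq_norm_sq ha, nsq_eq_norm_sq hb]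
  exact bdf2_energy hδ (by rw [← e0]; exact h)

theorem euler_energy_fields {a b : E d → F} {δ ζ A R : ℝ} (hδ : 0 < δ) (hζ : 0 ≤ ζ)
    (ha : MemLp a 2 (volume.restrict Ω)) (hb : MemLp b 2 (volume.restrict Ω))
    (h : ζ * ip Ω (fun x => δ⁻¹ • (a x - b x)) a + A = R) :
    ζ * nsq Ω a + 2 * δ * A ≤ ζ * nsq Ω b + 2 * δ * R := by
  have e0 : ip Ω (fun x => δ⁻¹ • (a x - b x)) a
      = inner ℝ (δ⁻¹ • (ha.toLp a - hb.toLp b)) (ha.toLp a) :=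
    ip_eq_inner ((ha.sub hb).const_smul δ⁻¹) ha
  rw [nsq_eq_norm_sq ha, nsq_eq_norm_sq hb]
  exact euler_energy hδ hζ (by rw [← e0]; exact h)

/-- The velocity update holds only almost everywhere; in L²(Ω) it becomes the equation that the
Hilbert space lemmas use. -/
theorem toLp_eq_of_projection {v a g f : E d → F} {σ : ℝ}
    (hv : MemLp v 2 (volume.restrict Ω)) (ha : MemLp a 2 (volume.restrict Ω))
    (hg : MemLp g 2 (volume.restrict Ω)) (hf : MemLp f 2 (volume.restrict Ω))
    (he : ∀ᵐ x ∂volume.restrict Ω, a x = v x - σ • g x + σ • f x) :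
    ha.toLp a = hv.toLp v - σ • hg.toLp g + σ • hf.toLp f :=
  (MemLp.toLp_eq_toLp_iff ha ((hv.sub (hg.const_smul σ)).add (hf.const_smul σ))).2 he

theorem bdf2_projection_energy_fields {v a b c g f : E d → F} {δ A R : ℝ} (hδ : 0 < δ)
    (hv : MemLp v 2 (volume.restrict Ω)) (ha : MemLp a 2 (volume.restrict Ω))
    (hb : MemLp b 2 (volume.restrict Ω)) (hc : MemLp c 2 (volume.restrict Ω))
    (hg : MemLp g 2 (volume.restrict Ω)) (hf : MemLp f 2 (volume.restrict Ω))
    (h : ip Ω (fun x => (2 * δ)⁻¹ • ((3 : ℝ) • v x - (4 : ℝ) • b x + c x)) v + A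
      + ip Ω f v = R)
    (he : ∀ᵐ x ∂volume.restrict Ω, a x = v x - (2 * δ / 3) • g x + (2 * δ / 3) • f x)
    (hag : ip Ω a g = 0) (haf : ip Ω a f = 0) (hbg : ip Ω b g = 0) (hbf : ip Ω b f = 0)
    (hcg : ip Ω c g = 0) (hcf : ip Ω c f = 0) :
    nsq Ω a + nsq Ω (fun x => (2 : ℝ) • a x - b x) + nsq Ω (fun x => a x - (2 : ℝ) • b x + c x)
        + 4 * δ ^ 2 / 3 * nsq Ω g + 4 * δ * A
      ≤ nsq Ω b + nsq Ω (fun x => (2 : ℝ) • b x - c x) + 4 * δ ^ 2 / 3 * nsq Ω f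
        + 4 * δ * R := by
  have e0 : ip Ω (fun x => (2 * δ)⁻¹ • ((3 : ℝ) • v x - (4 : ℝ) • b x + c x)) v
      = inner ℝ ((2 * δ)⁻¹ • ((3 : ℝ) • hv.toLp v - (4 : ℝ) • hb.toLp b + hc.toLp c))
        (hv.toLp v) :=
    ip_eq_inner ((((hv.const_smul (3 : ℝ)).sub (hb.const_smul (4 : ℝ))).add hc).const_smul
      (2 * δ)⁻¹) hv
  have e1 : nsq Ω (fun x => (2 : ℝ) • a x - b x) = ‖(2 : ℝ) • ha.toLp a - hb.toLp b‖ ^ 2 :=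
    nsq_eq_norm_sq ((ha.const_smul (2 : ℝ)).sub hb)
  have e2 : nsq Ω (fun x => (2 : ℝ) • b x - c x) = ‖(2 : ℝ) • hb.toLp b - hc.toLp c‖ ^ 2 :=
    nsq_eq_norm_sq ((hb.const_smul (2 : ℝ)).sub hc)
  have e3 : nsq Ω (fun x => a x - (2 : ℝ) • b x + c x)
      = ‖ha.toLp a - (2 : ℝ) • hb.toLp b + hc.toLp c‖ ^ 2 :=
    nsq_eq_norm_sq ((ha.sub (hb.const_smul (2 : ℝ))).add hc)
  rw [e1, e2, e3, nsq_eq_norm_sq ha, nsq_eq_norm_sq hb, nsq_eq_norm_sq hg, nsq_eq_norm_sq hf]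
  rw [e0, ip_eq_inner hf hv] at h
  rw [ip_eq_inner ha hg] at hag
  rw [ip_eq_inner ha hf] at haf
  rw [ip_eq_inner hb hg] at hbg
  rw [ip_eq_inner hb hf] at hbf
  rw [ip_eq_inner hc hg] at hcg
  rw [ip_eq_inner hc hf] at hcf
  exact bdf2_projection_energy hδ h (toLp_eq_of_projection hv ha hg hf he) hag haf hbg hbf hcg hcf

theorem euler_projection_energy_fields {v a b g f : E d → F} {δ A R : ℝ} (hδ : 0 < δ)
    (hv : MemLp v 2 (volume.restrict Ω)) (ha : MemLp a 2 (volume.restrict Ω))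
    (hb : MemLp b 2 (volume.restrict Ω))
    (hg : MemLp g 2 (volume.restrict Ω)) (hf : MemLp f 2 (volume.restrict Ω))
    (h : ip Ω (fun x => δ⁻¹ • (v x - b x)) v + A + ip Ω f v = R)
    (he : ∀ᵐ x ∂volume.restrict Ω, a x = v x - δ • g x + δ • f x)
    (hag : ip Ω a g = 0) (haf : ip Ω a f = 0) (hbg : ip Ω b g = 0) (hbf : ip Ω b f = 0) :
    nsq Ω a + 4 * δ ^ 2 / 3 * nsq Ω g + 2 * δ * A
      ≤ nsq Ω b + 3 * δ ^ 2 / 2 * nsq Ω f + 2 * δ * R := by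
  have e0 : ip Ω (fun x => δ⁻¹ • (v x - b x)) v
      = inner ℝ (δ⁻¹ • (hv.toLp v - hb.toLp b)) (hv.toLp v) :=
    ip_eq_inner ((hv.sub hb).const_smul δ⁻¹) hv
  rw [nsq_eq_norm_sq ha, nsq_eq_norm_sq hb, nsq_eq_norm_sq hg, nsq_eq_norm_sq hf]
  rw [e0, ip_eq_inner hf hv] at h
  rw [ip_eq_inner ha hg] at hag
  rw [ip_eq_inner ha hf] at haf
  rw [ip_eq_inner hb hg] at hbg
  rw [ip_eq_inner hb hf] at hbf
  exact euler_projection_energy hδ h (toLp_eq_of_projection hv ha hg hf he) hag haf hbg hbf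

end Fields

/-! ### Energy estimates for single steps and their sum -/

section Estimates

variable {d : ℕ} {Ω : Set (E d)} {T : Triangulation Ω} {P : Params} {k l r s : ℕ} {δ C : ℝ}
  {S : Fields d}

/-- The energy at the levels `n` and `n + 1`, with the pressure contribution. -/
noncomputable def levelEnergy (Ω : Set (E d)) (P : Params) (δ : ℝ) (S : Fields d) (n : ℕ) : ℝ :=
  nsq Ω (S.u (n + 1)) + nsq Ω (fun x => (2 : ℝ) • S.u (n + 1) x - S.u n x)
    + P.zeta * nsq Ω (S.w (n + 1)) + P.zeta * nsq Ω (fun x => (2 : ℝ) • S.w (n + 1) x - S.w n x)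
    + nsq Ω (S.th (n + 1)) + nsq Ω (fun x => (2 : ℝ) * S.th (n + 1) x - S.th n x)
    + 4 * δ ^ 2 / 3 * nsq Ω (grad Ω (S.p (n + 1)))

/-- The sum of the squared second differences at level `n`. -/
noncomputable def diffEnergy (Ω : Set (E d)) (P : Params) (S : Fields d) (n : ℕ) : ℝ :=
  secondDiffSq Ω S.u n + P.zeta * secondDiffSq Ω S.w n + secondDiffSq Ω S.th n

/-- The dissipation of the step from level `n` to level `n + 1`. -/
noncomputable def dissipation (Ω : Set (E d)) (P : Params) (S : Fields d) (n : ℕ) : ℝ :=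
  (P.chi + P.mu) * nsq Ω (jac Ω (S.ut (n + 1))) + P.ups * nsq Ω (jac Ω (S.w (n + 1)))
    + 4 * P.eta * nsq Ω (divSpin Ω (S.w (n + 1))) + 16 * P.chi * nsq Ω (S.w (n + 1))
    + P.kappa * nsq Ω (grad Ω (S.th (n + 1)))

/-- The energy estimate for one second-order step. -/
theorem IsStep.energy_le (hδ : 0 < δ) {m : ℕ} (h : IsStep P T k l r s δ S (m + 1))
    (h0 : IsRegularLevel T l r s S m) (h1 : IsRegularLevel T l r s S (m + 1))
    (hs : SourceBound Ω P C (extrap S.u (m + 1)) (extrap S.w (m + 1)) (extrap S.th (m + 1))) :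
    levelEnergy Ω P δ S (m + 1) + diffEnergy Ω P S (m + 1) + δ * dissipation Ω P S (m + 1)
      ≤ levelEnergy Ω P δ S m + 12 * C * δ * extrapSq Ω S (m + 1) := by
  have h2 := h.isRegularLevel hδ h1
  have eu := h.momentum _ h.ut_mem
  have ew := h.spin _ h.w_mem
  have et := h.temperature _ h.th_mem
  rw [bForm_self, ← nsq_eq_ip, add_zero] at eu
  rw [bForm_self, ← nsq_eq_ip, ← nsq_eq_ip, ← nsq_eq_ip, mul_zero, add_zero, add_assoc, add_assoc]
    at ew
  rw [bFormS_self, ← nsq_eq_ip, add_zero] at et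
  have bu := hs.1 _ h.ut_mem.memH10
  have bw := hs.2.1 _ h.w_mem.memH10
  have bt := hs.2.2 _ h.th_mem.2
  have iu := bdf2_projection_energy_fields hδ (memLp_of_memH10 h.ut_mem.memH10) h2.u_memLp
    h1.u_memLp h0.u_memLp h2.p_mem.2.1.memLp_grad h1.p_mem.2.1.memLp_grad eu h.velocity
    (h2.u_div _ h2.p_mem) (h2.u_div _ h1.p_mem) (h1.u_div _ h2.p_mem) (h1.u_div _ h1.p_mem)
    (h0.u_div _ h2.p_mem) (h0.u_div _ h1.p_mem)
  have iw := bdf2_energy_fields hδ (memLp_of_memH10 h2.w_mem.memH10)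
    (memLp_of_memH10 h1.w_mem.memH10) (memLp_of_memH10 h0.w_mem.memH10) ew
  have it : 1 * (nsq Ω (S.th (m + 1 + 1))
        + nsq Ω (fun x => (2 : ℝ) * S.th (m + 1 + 1) x - S.th (m + 1) x)
        + secondDiffSq Ω S.th (m + 1)) + 4 * δ * (P.kappa * nsq Ω (grad Ω (S.th (m + 1 + 1))))
      = 1 * (nsq Ω (S.th (m + 1)) + nsq Ω (fun x => (2 : ℝ) * S.th (m + 1) x - S.th m x))
        + 4 * δ * ip Ω (fun x => inner ℝ (extrap S.u (m + 1) x) (vert d)) (S.th (m + 1 + 1)) :=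
    bdf2_energy_fields hδ h2.th_mem.2.1.1 h1.th_mem.2.1.1 h0.th_mem.2.1.1
      (by rw [one_mul]; exact et)
  have du : secondDiffSq Ω S.u (m + 1)
    = nsq Ω fun x => S.u (m + 1 + 1) x - (2 : ℝ) • S.u (m + 1) x + S.u m x := rfl
  have dw : secondDiffSq Ω S.w (m + 1)
    = nsq Ω fun x => S.w (m + 1 + 1) x - (2 : ℝ) • S.w (m + 1) x + S.w m x := rfl
  rw [← du] at iu
  rw [← dw] at iw
  -- Each of the three equations contributes 4δ · C times the data norms, hence the constant 12C.
  have mu := mul_le_mul_of_nonneg_left bu (by positivity : 0 ≤ 4 * δ)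
  have mw := mul_le_mul_of_nonneg_left bw (by positivity : 0 ≤ 4 * δ)
  have mt := mul_le_mul_of_nonneg_left bt (by positivity : 0 ≤ 4 * δ)
  -- Of the factor 4δ in front of each viscous term the sources use 2δ and the estimate keeps δ; the
  -- remaining δ is dropped.
  have ju : 0 ≤ δ * ((P.chi + P.mu) * nsq Ω (jac Ω (S.ut (m + 1 + 1)))) :=
    mul_nonneg hδ.le (mul_nonneg (add_pos P.chi_pos P.mu_pos).le (nsq_nonneg _))
  have jw : 0 ≤ δ * (P.ups * nsq Ω (jac Ω (S.w (m + 1 + 1)))) :=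
    mul_nonneg hδ.le (mul_nonneg P.ups_pos.le (nsq_nonneg _))
  have jt : 0 ≤ δ * (P.kappa * nsq Ω (grad Ω (S.th (m + 1 + 1)))) :=
    mul_nonneg hδ.le (mul_nonneg P.kappa_pos.le (nsq_nonneg _))
  simp only [levelEnergy, diffEnergy, dissipation, extrapSq]
  linarith

/-- The energy estimate for the first-order starting step. -/
theorem IsFirstStep.energy_le (hδ : 0 < δ) (h : IsFirstStep P T k l r s δ S)
    (h0 : IsRegularLevel T l r s S 0) (hs : SourceBound Ω P C (S.u 0) (S.w 0) (S.th 0)) :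
    levelEnergy Ω P δ S 0 ≤ initialEnergy Ω P S 0 + 3 * δ ^ 2 / 2 * nsq Ω (grad Ω (S.p 0))
      + 6 * C * δ * extrapSq Ω S 0 := by
  have h1 := h.isRegularLevel hδ h0
  have eu := h.momentum _ h.ut_mem
  have ew := h.spin _ h.w_mem
  have et := h.temperature _ h.th_mem
  rw [bForm_self, ← nsq_eq_ip, add_zero] at eu
  rw [bForm_self, ← nsq_eq_ip, ← nsq_eq_ip, ← nsq_eq_ip, mul_zero, add_zero, add_assoc, add_assoc]
    at ew
  rw [bFormS_self, ← nsq_eq_ip, add_zero] at et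
  have bu := hs.1 _ h.ut_mem.memH10
  have bw := hs.2.1 _ h.w_mem.memH10
  have bt := hs.2.2 _ h.th_mem.2
  have iu := euler_projection_energy_fields hδ (memLp_of_memH10 h.ut_mem.memH10) h1.u_memLp
    h0.u_memLp h1.p_mem.2.1.memLp_grad h0.p_mem.2.1.memLp_grad eu h.velocity
    (h1.u_div _ h1.p_mem) (h1.u_div _ h0.p_mem) (h0.u_div _ h1.p_mem) (h0.u_div _ h0.p_mem)
  have iw := euler_energy_fields hδ P.zeta_pos.le (memLp_of_memH10 h1.w_mem.memH10)
    (memLp_of_memH10 h0.w_mem.memH10) ew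
  have it := euler_energy_fields hδ zero_le_one h1.th_mem.2.1.1 h0.th_mem.2.1.1
    (A := P.kappa * nsq Ω (grad Ω (S.th 1)))
    (R := ip Ω (fun x => inner ℝ (S.u 0 x) (vert d)) (S.th 1)) (by rw [one_mul]; exact et)
  have mu := mul_le_mul_of_nonneg_left bu (by positivity : 0 ≤ 2 * δ)
  have mw := mul_le_mul_of_nonneg_left bw (by positivity : 0 ≤ 2 * δ)
  have mt := mul_le_mul_of_nonneg_left bt (by positivity : 0 ≤ 2 * δ)
  -- All dissipation left over from the starting step is dropped.
  have ju : 0 ≤ δ * ((P.chi + P.mu) * nsq Ω (jac Ω (S.ut 1))) :=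
    mul_nonneg hδ.le (mul_nonneg (add_pos P.chi_pos P.mu_pos).le (nsq_nonneg _))
  have jw : 0 ≤ δ * (P.ups * nsq Ω (jac Ω (S.w 1))) :=
    mul_nonneg hδ.le (mul_nonneg P.ups_pos.le (nsq_nonneg _))
  have jt : 0 ≤ δ * (P.kappa * nsq Ω (grad Ω (S.th 1))) :=
    mul_nonneg hδ.le (mul_nonneg P.kappa_pos.le (nsq_nonneg _))
  have jd : 0 ≤ δ * (P.eta * nsq Ω (divSpin Ω (S.w 1))) :=
    mul_nonneg hδ.le (mul_nonneg P.eta_pos.le (nsq_nonneg _))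
  have jc : 0 ≤ δ * (P.chi * nsq Ω (S.w 1)) :=
    mul_nonneg hδ.le (mul_nonneg P.chi_pos.le (nsq_nonneg _))
  -- The terms in 2f¹ - f⁰ occur on both sides, so only the norms at level 1 have to be traded for
  -- those at level 0. The extrapolated fields at level 0 are the fields themselves.
  simp only [levelEnergy, initialEnergy, extrapSq, extrap, zero_add]
  linarith

/-- The summed energy estimate for the second-order steps. -/
theorem sum_energy_le (hδ : 0 < δ) {N : ℕ}
    (h : ∀ n, 1 ≤ n → n ≤ N → IsStep P T k l r s δ S n)
    (h0 : IsRegularLevel T l r s S 0) (h1 : IsRegularLevel T l r s S 1)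
    (hC : ∀ (u : E d → E d) (w : E d → E (spinDim d)) (θ : E d → ℝ),
      MemLp u 2 (volume.restrict Ω) → (∃ c, HasWeakCurl Ω u c) →
      (∀ a, MemH1 Ω fun x => w x a) → MemLp θ 2 (volume.restrict Ω) → SourceBound Ω P C u w θ) :
    levelEnergy Ω P δ S N + ∑ n ∈ Finset.Icc 1 N, diffEnergy Ω P S n
        + δ * ∑ n ∈ Finset.Icc 1 N, dissipation Ω P S n
      ≤ levelEnergy Ω P δ S 0 + 12 * C * δ * ∑ n ∈ Finset.Icc 1 N, extrapSq Ω S n := by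
  -- A step hands regularity on from level n to level n + 1, so it propagates from the two starting
  -- levels.
  have hreg : ∀ n ≤ N, IsRegularLevel T l r s S n ∧ IsRegularLevel T l r s S (n + 1) := by
    intro n
    induction n with
    | zero => exact fun _ => ⟨h0, h1⟩
    | succ n ih =>
      intro hn
      have hp := (ih (Nat.le_of_succ_le hn)).2
      exact ⟨hp, (h (n + 1) (Nat.le_add_left 1 n) hn).isRegularLevel hδ hp⟩
  induction N with
  | zero => simp
  | succ N ih =>
    have i1 := ih (fun n h1 h2 => h n h1 (Nat.le_succ_of_le h2))
      fun n hn => hreg n (Nat.le_succ_of_le hn)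
    obtain ⟨r0, r1⟩ := hreg N (Nat.le_succ N)
    obtain ⟨mu, cu⟩ := r0.extrap_u r1
    have i2 := (h (N + 1) (Nat.le_add_left 1 N) le_rfl).energy_le hδ r0 r1
      (hC _ _ _ mu cu (r0.extrap_w r1) (r0.extrap_th r1))
    simp only [Finset.sum_Icc_succ_top (Nat.le_add_left 1 N)]
    linarith

/-- The only loss is in the pressure, whose weight drops from 4δ²/3 to δ²/3. -/
theorem stabilityLHS_le (N : ℕ) :
    stabilityLHS Ω P δ S N ≤ levelEnergy Ω P δ S N + ∑ n ∈ Finset.Icc 1 N, diffEnergy Ω P S n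
      + δ * ∑ n ∈ Finset.Icc 1 N, dissipation Ω P S n := by
  have h : 0 ≤ δ ^ 2 * nsq Ω (grad Ω (S.p (N + 1))) := mul_nonneg (sq_nonneg _) (nsq_nonneg _)
  simp only [stabilityLHS, levelEnergy, diffEnergy, dissipation]
  linarith

end Estimates

end Micropolar

/-! ### The stability theorem -/

theorem theorem3p1 {d : ℕ} (hd : d = 2 ∨ d = 3) (Ω : Set (Micropolar.E d)) (hΩ : IsOpen Ω)
    (hb : Bornology.IsBounded Ω) (P : Micropolar.Params) :
    ∃ C : ℝ, 0 < C ∧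
      ∀ (T : Micropolar.Triangulation Ω) (k l r s : ℕ) (δ : ℝ) (N : ℕ) (S : Micropolar.Fields d),
        0 < δ → (∀ n, 1 ≤ n → n ≤ N → Micropolar.IsStep P T k l r s δ S n) →
        Micropolar.IsStart T k l r s S 0 →
        (Micropolar.IsStart T k l r s S 1 →
          Micropolar.stabilityLHS Ω P δ S N ≤ Micropolar.initialEnergy Ω P S 1
            + 4 * δ ^ 2 / 3 * Micropolar.nsq Ω (Micropolar.grad Ω (S.p 1))
            + C * δ * ∑ n ∈ Finset.Icc 1 N, Micropolar.extrapSq Ω S n) ∧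
        (Micropolar.IsFirstStep P T k l r s δ S →
          Micropolar.stabilityLHS Ω P δ S N ≤ Micropolar.initialEnergy Ω P S 0
            + 3 * δ ^ 2 / 2 * Micropolar.nsq Ω (Micropolar.grad Ω (S.p 0))
            + C * δ * ∑ n ∈ Finset.range (N + 1), Micropolar.extrapSq Ω S n) := by
  have hR : ∃ R : ℝ, ∀ x ∈ Ω, ‖x‖ ≤ R := hb.exists_norm_le
  obtain ⟨C, hC, hsrc⟩ := Micropolar.exists_source_le (by omega : 0 < d) hR P
  refine ⟨12 * C, by positivity, fun T k l r s δ N S hδ hstep h0 => ⟨fun h1 => ?_, fun h1 => ?_⟩⟩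
  · have h := Micropolar.sum_energy_le hδ hstep h0.isRegularLevel h1.isRegularLevel hsrc
    -- The level energy at 0 unfolds to I₁ plus the term in ∇p¹.
    exact (Micropolar.stabilityLHS_le N).trans h
  · have r0 := h0.isRegularLevel
    have h := Micropolar.sum_energy_le hδ hstep r0 (h1.isRegularLevel hδ r0) hsrc
    have hf := h1.energy_le hδ r0 (hsrc _ _ _ r0.u_memLp r0.u_curl
      (fun a => (r0.w_mem.memH10 a).1) r0.th_mem.2.1.1)
    -- The starting step needs only 6C at n = 0; nonnegativity lets 12C serve for the whole sum.
    have hx : 0 ≤ C * δ * Micropolar.extrapSq Ω S 0 := by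
      have := Micropolar.nsq_nonneg (Ω := Ω) (Micropolar.extrap S.u 0)
      have := Micropolar.nsq_nonneg (Ω := Ω) (Micropolar.extrap S.w 0)
      have := Micropolar.nsq_nonneg (Ω := Ω) (Micropolar.extrap S.th 0)
      unfold Micropolar.extrapSq
      positivity
    have hsum : ∑ n ∈ Finset.range (N + 1), Micropolar.extrapSq Ω S n
        = Micropolar.extrapSq Ω S 0 + ∑ n ∈ Finset.Icc 1 N, Micropolar.extrapSq Ω S n := by
      rw [Finset.range_eq_Ico, Finset.sum_eq_sum_Ico_succ_bot (Nat.succ_pos N)]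
      rfl
    rw [hsum]
    have := Micropolar.stabilityLHS_le (Ω := Ω) (P := P) (δ := δ) (S := S) N
    linarith
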